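/- **Theorem 3 (model-assisted generalized entropy calibration).** Consider a sequence of finite populations $U=\{1,\dots,N\}$ with $N\to\infty$. Unit $i\in U$ has non-random values $\bm x_i\in\mathbb R^p$, $y_i\in\mathbb R$, $c_i>0$. A sample $A\subseteq U$ of (possibly random) size $n=|A|$ is drawn by a probability sampling design with inclusion probabilities $\pi_i=P(i\in A)$ and $\pi_{ij}=P(i,j\in A)$; put $d_i=\pi_i^{-1}$. Let $\mathcal V\subseteq\mathbb R$ be an interval, $G:\mathcal V\to\mathbb R$, $g=G'$, and $\bm z_i^\top=(\bm x_i^\top,\,g(d_i)c_i)\in\mathbb R^{p+1}$. All probabilities are taken under the sampling design. Assume: 1. $G$ is strictly convex and twice continuously differentiable on $\mathcal V$, with $g'>0$ in the interior of $\mathcal V$; 2. there are positive constants $c_1,c_2$ in the interior of $\mathcal V$ with $c_1<d_i<c_2$ for all $i$ and all populations; 3. $\limsup_{N\to\infty} N\max_{i\ne j}|\pi_{ij}-\pi_i\pi_j|<\infty$; 4. $\bm\Sigma_{\bm z}=\lim_{N\to\infty}N^{-1}\sum_{i\in U}\bm z_i\bm z_i^\top$ exists and is positive definite, and $\limsup_{N\to\infty}N^{-1}\sum_{i\in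 U}\|(y_i,\bm x_i^\top,c_i)\|^4<\infty$; 5. $c_i\ge c_0$ for all $i$ and all populations, for some constant $c_0>0$. Consider the problem of minimizing $\sum_{i\in A}c_iG(\omega_i)$ over $(\omega_i)_{i\in A}\in\mathcal V^n$ subject to the benchmarking constraint $\sum_{i\in A}\omega_i\bm x_i=\sum_{i\in U}\bm x_i$ and the debiasing constraint $\sum_{i\in A}\omega_i g(d_i)c_i=\sum_{i\in U}g(d_i)c_i$. Then, with probability tending to $1$, a solution $(\hat\omega_i)_{i\in A}$ exists and is unique. Moreover, if $\bm\gamma^*\in\mathbb R^{p+1}$ is the limit in probability of $$\hat{\bm\gamma}=\Big(\sum_{i\in A}\frac{\bm z_i\bm z_i^\top}{g'(d_i)c_i}\Big)^{-1}\sum_{i\in A}\frac{\bm z_iy_i}{g'(d_i)c_i},$$ then $\hat\theta_{\rm cal}=\sum_{i\in A}\hat\omega_iy_i$ satisfies $$\hat\theta_{\rm cal}=\hat\theta_{{\rm greg},\ell}+o_p(n^{-1/2}N),\qquad \hat\theta_{{\rm greg},\ell}=\sum_{i\in U}\bm z_i^\top\bm\gamma^*+\sum_{i\in A}\frac1{\pi_i}\big(y_i-\bm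 z_i^\top\bm\gamma^*\big).$$ -/

import Mathlib

open Filter Topology Matrix

noncomputable section

/-- A finite population `U = {1, …, N}` of units with covariates `x i ∈ ℝᵖ`, study variable `y i`,
variance factors `c i`, and a sampling design, i.e. a probability law on the subsets of `U`. -/
structure SurveyPopulation (p : ℕ) where
  N : ℕ
  x : Fin N → Fin p → ℝ
  y : Fin N → ℝ
  c : Fin N → ℝ
  design : PMF (Finset (Fin N))

namespace SurveyPopulation

variable {p : ℕ} (P : SurveyPopulation p)

/-- The probability that the sample `A` satisfies `E`, under the sampling design. -/
def prob (E : Set (Finset (Fin P.N))) : ℝ :=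
  ∑ A : Finset (Fin P.N), E.indicator (fun A => (P.design A).toReal) A

/-- First-order inclusion probability `π_i`. -/
def incl (i : Fin P.N) : ℝ := P.prob {A | i ∈ A}

/-- Joint inclusion probability `π_ij`. -/
def incl₂ (i j : Fin P.N) : ℝ := P.prob {A | i ∈ A ∧ j ∈ A}

/-- Design weight `d_i = 1 / π_i`. -/
def d (i : Fin P.N) : ℝ := (P.incl i)⁻¹

/-- Augmented covariate `z_i = (x_i, g(d_i) c_i) ∈ ℝᵖ⁺¹`, where `g = G'`. -/
def z (G : ℝ → ℝ) (i : Fin P.N) : Fin (p + 1) → ℝ :=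
  Fin.snoc (α := fun _ => ℝ) (P.x i) (deriv G (P.d i) * P.c i)

/-- Weights on the sample `A`, with values in `V`, that satisfy the benchmarking constraint
`∑_A ω_i x_i = ∑_U x_i` and the debiasing constraint `∑_A ω_i g(d_i) c_i = ∑_U g(d_i) c_i`. -/
def feasible (G : ℝ → ℝ) (V : Set ℝ) (A : Finset (Fin P.N)) : Set (A → ℝ) :=
  {ω | (∀ i, ω i ∈ V) ∧
    ∑ i : A, ω i • P.x i = ∑ i, P.x i ∧
    ∑ i : A, ω i * (deriv G (P.d i) * P.c i) = ∑ i, deriv G (P.d i) * P.c i}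

/-- `ω` minimizes `∑_A c_i G(ω_i)` over the feasible weights. -/
def IsCalibrationWeight (G : ℝ → ℝ) (V : Set ℝ) (A : Finset (Fin P.N)) (ω : A → ℝ) : Prop :=
  ω ∈ P.feasible G V A ∧
    IsMinOn (fun ω : A → ℝ => ∑ i : A, P.c i * G (ω i)) (P.feasible G V A) ω

/-- The linear estimator `∑_A ω_i y_i`. -/
def linearEstimator (A : Finset (Fin P.N)) (ω : A → ℝ) : ℝ := ∑ i : A, ω i * P.y i

/-- The generalized regression estimator
`∑_U z_iᵀ γ + ∑_A π_i⁻¹ (y_i - z_iᵀ γ)` with coefficient `γ`. -/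
def greg (G : ℝ → ℝ) (γ : Fin (p + 1) → ℝ) (A : Finset (Fin P.N)) : ℝ :=
  ∑ i, P.z G i ⬝ᵥ γ + ∑ i ∈ A, (P.incl i)⁻¹ * (P.y i - P.z G i ⬝ᵥ γ)

/-- The sample regression coefficient
`(∑_A z_i z_iᵀ / (g'(d_i) c_i))⁻¹ ∑_A z_i y_i / (g'(d_i) c_i)`. -/
def gammaHat (G : ℝ → ℝ) (A : Finset (Fin P.N)) : Fin (p + 1) → ℝ :=
  (∑ i ∈ A, (1 / (deriv (deriv G) (P.d i) * P.c i)) • vecMulVec (P.z G i) (P.z G i))⁻¹ *ᵥ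
    ∑ i ∈ A, (P.y i / (deriv (deriv G) (P.d i) * P.c i)) • P.z G i

end SurveyPopulation

/-- `T ν →ₚ t` along a sequence of populations, under their sampling designs. -/
def TendstoInDesignProb {p : ℕ} (P : ℕ → SurveyPopulation p) {E : Type*} [PseudoMetricSpace E]
    (T : ∀ ν, Finset (Fin (P ν).N) → E) (t : E) : Prop :=
  ∀ ε : ℝ, 0 < ε → Tendsto (fun ν => (P ν).prob {A | ε < dist (T ν A) t}) atTop (𝓝 0)

/-- `T ν = o_p(r ν)` along a sequence of populations, under their sampling designs; the rate `r`
may depend on the sample. -/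
def IsLittleODesignProb {p : ℕ} (P : ℕ → SurveyPopulation p)
    (T r : ∀ ν, Finset (Fin (P ν).N) → ℝ) : Prop :=
  ∀ ε : ℝ, 0 < ε → Tendsto (fun ν => (P ν).prob {A | ε * r ν A < |T ν A|}) atTop (𝓝 0)

end

/-! At an interior minimizer the Lagrange conditions read `c_i g(ω_i) = z_iᵀ λ`. Since the last
coordinate of `z_i` is `g(d_i) c_i`, the multiplier `e_last` reproduces the design weights. With `λ
= e_last + v` and `h = g⁻¹`, the weights are `h(g(d_i) + z_iᵀ v / c_i)`, and the constraints become
an equation for `v`: the vanishing gradient of a convex dual function.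

At `v = 0` the gradient is the Horvitz–Thompson error of `∑ z_i`, of order `√N` by Chebyshev. The
curvature is of order `N`, because the sample second moments of `z_i` stay close to a positive
definite limit. So the dual has a minimizer with `‖v‖ = O(N^{-1/2})`
(`exists_solution_estimatingEquation`). Fourth moments make `max ‖z_i‖ = o(√N)`, so the weights are
uniformly close to the `d_i` and stay inside `V`. Convexity makes the Lagrange conditions
sufficient, and strict convexity gives uniqueness.

By the constraints, `θ̂_cal - θ̂_greg = ∑_A (ω̂_i - d_i)(y_i - z_iᵀ γ*)`. To first order `ω̂_i -
d_i` is `z_iᵀ v / (g'(d_i) c_i)`, and the normal equations turn this part into a form in `v` and `γ̂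
- γ*`, of size `N ‖v‖ o_p(1)`. Uniform continuity of `g'` controls the remainder
(`abs_sum_mul_y_sub_greg_le`). Both are `o_p(√N)`, and `√N ≤ n^{-1/2} N`. The estimates are
deterministic on `goodSamples`; randomness enters only through the probability of that event and of
`γ̂` being near `γ*`. -/

/-! ### Convexity and inversion on the line. -/

/-- The tangent line of a convex function lies below its graph. -/
theorem ConvexOn.add_mul_sub_le_of_hasDerivAt {V : Set ℝ} {f : ℝ → ℝ} {f' x y : ℝ}
    (hf : ConvexOn ℝ V f) (hx : x ∈ V) (hy : y ∈ V) (hd : HasDerivAt f f' x) :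
    f x + f' * (y - x) ≤ f y := by
  rcases lt_trichotomy x y with h | rfl | h
  · have := hf.le_slope_of_hasDerivAt hx hy h hd
    rw [slope_def_field, le_div_iff₀ (by linarith)] at this
    linarith
  · simp
  · have := hf.slope_le_of_hasDerivAt hy hx h hd
    rw [slope_def_field, div_le_iff₀ (by linarith)] at this
    linarith

/-- A primitive of a function with slopes at least `μ` grows quadratically above its tangents. -/
theorem add_mul_sub_add_sq_le_of_hasDerivAt {H h : ℝ → ℝ} {μ : ℝ}
    (hH : ∀ u, HasDerivAt H (h u) u) (hμ : ∀ u v, u ≤ v → μ * (v - u) ≤ h v - h u) (u v : ℝ) :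
    H u + h u * (v - u) + μ / 2 * (v - u) ^ 2 ≤ H v := by
  -- Subtracting `μ s² / 2` leaves a function with nondecreasing derivative, hence convex.
  have hd : ∀ w, HasDerivAt (fun s => H s - μ / 2 * s ^ 2) (h w - μ * w) w := fun w => by
    refine ((hH w).sub ((hasDerivAt_pow 2 w).const_mul (μ / 2))).congr_deriv ?_
    push_cast; ring
  have hmono : Monotone (deriv fun s => H s - μ / 2 * s ^ 2) := fun a b hab => by
    rw [(hd a).deriv, (hd b).deriv]
    linarith [hμ a b hab]
  have := (hmono.convexOn_univ_of_deriv fun w => (hd w).differentiableAt).add_mul_sub_le_of_hasDerivAt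
    (Set.mem_univ u) (Set.mem_univ v) (hd u)
  nlinarith

/-- A function on `ℝ` whose slopes lie between positive constants has a continuous inverse. -/
theorem exists_continuous_rightInverse_of_slope_bounds {f : ℝ → ℝ} {m M : ℝ} (hm : 0 < m)
    (hlo : ∀ x y, x ≤ y → m * (y - x) ≤ f y - f x) (hhi : ∀ x y, x ≤ y → f y - f x ≤ M * (y - x)) :
    ∃ h : ℝ → ℝ, Continuous h ∧ Function.RightInverse h f ∧ Function.LeftInverse h f := by
  have hmono : StrictMono f := fun x y hxy => by
    have := hlo x y hxy.le
    have := mul_pos hm (sub_pos.2 hxy)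
    linarith
  have hM : 0 ≤ M := by
    have h1 := hlo 0 1 zero_le_one
    have h2 := hhi 0 1 zero_le_one
    linarith
  have hcont : Continuous f := by
    refine (LipschitzWith.of_dist_le_mul (K := M.toNNReal) fun x y => ?_).continuous
    rw [Real.coe_toNNReal M hM, Real.dist_eq, Real.dist_eq]
    rcases le_total x y with h | h
    · rw [abs_sub_comm, abs_sub_comm x, abs_of_nonneg (sub_nonneg.2 (hmono.monotone h)),
        abs_of_nonneg (sub_nonneg.2 h)]
      exact hhi x y h
    · rw [abs_of_nonneg (sub_nonneg.2 (hmono.monotone h)), abs_of_nonneg (sub_nonneg.2 h)]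
      exact hhi y x h
  have htop : Tendsto f atTop atTop := by
    refine tendsto_atTop_mono' atTop (f₁ := fun x => m * x + f 0) ?_
      (tendsto_atTop_add_const_right _ _ (tendsto_id.const_mul_atTop hm))
    filter_upwards [eventually_ge_atTop 0] with x hx
    have := hlo 0 x hx
    linarith
  have hbot : Tendsto f atBot atBot := by
    refine tendsto_atBot_mono' atBot (f₁ := fun x => m * x + f 0) ?_
      (tendsto_atBot_add_const_right _ _ (tendsto_id.const_mul_atBot hm))
    filter_upwards [eventually_le_atBot 0] with x hx
    have := hlo x 0 hx
    linarith
  let e := hmono.orderIsoOfSurjective f (hcont.surjective htop hbot)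
  exact ⟨e.symm, e.symm.continuous, e.apply_symm_apply, e.symm_apply_apply⟩

/-- A function with derivative between positive constants on `[a, b]` has an inverse on its image
that extends to a bi-Lipschitz increasing function on `ℝ`. -/
theorem exists_biLipschitz_inverse {g : ℝ → ℝ} {a b m M : ℝ} (hab : a ≤ b) (hm : 0 < m)
    (hg : ∀ w ∈ Set.Icc a b, DifferentiableAt ℝ g w)
    (hlo : ∀ w ∈ Set.Icc a b, m ≤ deriv g w) (hhi : ∀ w ∈ Set.Icc a b, deriv g w ≤ M) :
    ∃ (h : ℝ → ℝ) (μ L : ℝ), 0 < μ ∧ 0 < L ∧ Continuous h ∧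
      (∀ u v, u ≤ v → μ * (v - u) ≤ h v - h u) ∧ (∀ u v, |h u - h v| ≤ L * |u - v|) ∧
      (∀ w ∈ Set.Icc a b, h (g w) = w) ∧ ∀ u, h u ∈ Set.Icc a b → g (h u) = u := by
  have hc : ContinuousOn g (Set.Icc a b) := fun w hw => (hg w hw).continuousAt.continuousWithinAt
  have hd : DifferentiableOn ℝ g (interior (Set.Icc a b)) :=
    fun w hw => (hg w (interior_subset hw)).differentiableWithinAt
  have h1 := (convex_Icc a b).mul_sub_le_image_sub_of_le_deriv hc hd
    fun w hw => hlo w (interior_subset hw)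
  have h2 := (convex_Icc a b).image_sub_le_mul_sub_of_deriv_le hc hd
    fun w hw => hhi w (interior_subset hw)
  -- `q` is the projection onto `[a, b]`; it is monotone and 1-Lipschitz.
  let q : ℝ → ℝ := fun w => max a (min b w)
  have hq : ∀ w, q w ∈ Set.Icc a b := fun w =>
    ⟨le_max_left _ _, max_le hab (min_le_left _ _)⟩
  have hq0 : ∀ w ∈ Set.Icc a b, q w = w := fun w hw => by
    simp only [q]
    rw [min_eq_right hw.2, max_eq_right hw.1]
  have hq1 : ∀ x y, x ≤ y → q x ≤ q y := fun x y hxy =>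
    max_le_max le_rfl (min_le_min le_rfl hxy)
  have hq2 : ∀ x y, x ≤ y → q y - q x ≤ y - x := fun x y hxy => by
    simp only [q]
    rcases max_cases a (min b x) with h | h <;> rcases max_cases a (min b y) with h' | h' <;>
      rcases min_cases b x with k | k <;> rcases min_cases b y with k' | k' <;> linarith
  -- `f` extends `g` from `[a, b]` with slope 1 on both sides, so its slopes lie between `min m 1`
  -- and `max M 1`.
  let f : ℝ → ℝ := fun w => g (q w) + (w - q w)
  have hflo : ∀ x y, x ≤ y → min m 1 * (y - x) ≤ f y - f x := fun x y hxy => by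
    have e1 := h1 _ (hq x) _ (hq y) (hq1 x y hxy)
    have e2 : min m 1 * (q y - q x) ≤ m * (q y - q x) :=
      mul_le_mul_of_nonneg_right (min_le_left _ _) (sub_nonneg.2 (hq1 x y hxy))
    have e3 : min m 1 * ((y - x) - (q y - q x)) ≤ 1 * ((y - x) - (q y - q x)) :=
      mul_le_mul_of_nonneg_right (min_le_right _ _) (sub_nonneg.2 (hq2 x y hxy))
    simp only [f]
    linarith
  have hfhi : ∀ x y, x ≤ y → f y - f x ≤ max M 1 * (y - x) := fun x y hxy => by
    have e1 := h2 _ (hq x) _ (hq y) (hq1 x y hxy)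
    have e2 : M * (q y - q x) ≤ max M 1 * (q y - q x) :=
      mul_le_mul_of_nonneg_right (le_max_left _ _) (sub_nonneg.2 (hq1 x y hxy))
    have e3 : 1 * ((y - x) - (q y - q x)) ≤ max M 1 * ((y - x) - (q y - q x)) :=
      mul_le_mul_of_nonneg_right (le_max_right _ _) (sub_nonneg.2 (hq2 x y hxy))
    simp only [f]
    linarith
  have hm1 : 0 < min m 1 := lt_min hm one_pos
  have hM1 : 0 < max M 1 := lt_max_of_lt_right one_pos
  obtain ⟨h, hcont, hr, hl⟩ := exists_continuous_rightInverse_of_slope_bounds hm1 hflo hfhi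
  have hmono : ∀ u v, u ≤ v → h u ≤ h v := fun u v huv => by
    by_contra! hlt
    have := hflo _ _ hlt.le
    rw [hr u, hr v] at this
    nlinarith
  refine ⟨h, (max M 1)⁻¹, (min m 1)⁻¹, inv_pos.2 hM1, inv_pos.2 hm1, hcont, ?_, ?_, ?_, ?_⟩
  · intro u v huv
    have := hfhi _ _ (hmono u v huv)
    rw [hr u, hr v] at this
    rwa [inv_mul_le_iff₀ hM1]
  · have key : ∀ u v, u ≤ v → |h v - h u| ≤ (min m 1)⁻¹ * |v - u| := fun u v huv => by
      have := hflo _ _ (hmono u v huv)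
      rw [hr u, hr v] at this
      rw [abs_of_nonneg (sub_nonneg.2 huv), abs_of_nonneg (sub_nonneg.2 (hmono u v huv))]
      rwa [le_inv_mul_iff₀ hm1]
    intro u v
    rcases le_total u v with huv | huv
    · rw [abs_sub_comm, abs_sub_comm u]
      exact key u v huv
    · exact key v u huv
  · intro w hw
    have : f w = g w := by simp [f, hq0 w hw]
    rw [← this, hl w]
  · intro u hu
    have := hr u
    simpa [f, hq0 _ hu] using this

/-! ### Solvability of the dual equation. -/

/-- The estimating equation `∑ h(u_i + z_iᵀ v / c_i) z_i = t` has a solution in the ball of radius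
`r` around `0`, if `h` increases at rate at least `μ`, the defect at `v = 0` is at most `β` and
`∑ (z_iᵀ v)² / c_i` is bounded below by `Q ‖v‖²` with `2 β < μ Q r`. -/
theorem exists_solution_estimatingEquation {ι κ : Type*} [Fintype κ] (A : Finset ι)
    (z : ι → κ → ℝ) (c u : ι → ℝ) (hc : ∀ i ∈ A, 0 < c i) (t : κ → ℝ) {h : ℝ → ℝ}
    (hcont : Continuous h) {μ Q β r : ℝ} (hμ : 0 < μ)
    (hmono : ∀ u v, u ≤ v → μ * (v - u) ≤ h v - h u)
    (hQ : ∀ v : κ → ℝ, Q * ‖v‖ ^ 2 ≤ ∑ i ∈ A, (z i ⬝ᵥ v) ^ 2 / c i)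
    (hβ : ∀ v : κ → ℝ, |(∑ i ∈ A, h (u i) • z i - t) ⬝ᵥ v| ≤ β * ‖v‖)
    (hr : 0 < r) (hβr : 2 * β < μ * Q * r) :
    ∃ v : κ → ℝ, ‖v‖ ≤ r ∧ ∑ i ∈ A, h (u i + z i ⬝ᵥ v / c i) • z i = t := by
  classical
  let H : ℝ → ℝ := fun s => ∫ x in (0 : ℝ)..s, h x
  have hH : ∀ s, HasDerivAt H (h s) s := fun s => (hcont.integral_hasStrictDerivAt 0 s).hasDerivAt
  have hHc : Continuous H := continuous_iff_continuousAt.2 fun s => (hH s).continuousAt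
  -- The gradient of `Ψ` at `v` is the defect of the equation, so critical points are solutions.
  let Ψ : (κ → ℝ) → ℝ := fun v => ∑ i ∈ A, c i * H (u i + z i ⬝ᵥ v / c i) - t ⬝ᵥ v
  have hdot : ∀ w : κ → ℝ, Continuous fun v : κ → ℝ => w ⬝ᵥ v := fun w => by
    unfold dotProduct; fun_prop
  have hΨc : Continuous Ψ := by
    refine (continuous_finsetSum _ fun i _ => ?_).sub (hdot t)
    exact continuous_const.mul (hHc.comp (continuous_const.add ((hdot _).div_const _)))
  -- On the sphere the linear term is at least `-β r` and the quadratic one at least `μ Q r² / 2`,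
  -- which wins by `hβr`. The minimum over the closed ball is thus attained in its interior.
  have hbd : ∀ v ∈ Metric.closedBall (0 : κ → ℝ) r \ Metric.ball 0 r, Ψ 0 < Ψ v := by
    intro v hv
    have hvr : ‖v‖ = r := by
      have h1 := hv.1
      have h2 := hv.2
      rw [mem_closedBall_zero_iff] at h1
      rw [mem_ball_zero_iff, not_lt] at h2
      exact le_antisymm h1 h2
    have h1 : ∀ i ∈ A, c i * H (u i) + h (u i) * (z i ⬝ᵥ v) + μ / 2 * ((z i ⬝ᵥ v) ^ 2 / c i)
        ≤ c i * H (u i + z i ⬝ᵥ v / c i) := fun i hi => by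
      have hci := hc i hi
      have := add_mul_sub_add_sq_le_of_hasDerivAt hH hmono (u i) (u i + z i ⬝ᵥ v / c i)
      rw [add_sub_cancel_left] at this
      have := mul_le_mul_of_nonneg_left this hci.le
      refine le_of_eq_of_le ?_ this
      field_simp
    have h2 := Finset.sum_le_sum h1
    simp only [Finset.sum_add_distrib, ← Finset.mul_sum] at h2
    have h3 : (∑ i ∈ A, h (u i) • z i - t) ⬝ᵥ v = ∑ i ∈ A, h (u i) * (z i ⬝ᵥ v) - t ⬝ᵥ v := by
      simp [sub_dotProduct, sum_dotProduct, smul_dotProduct]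
    have h4 := (abs_le.1 (hβ v)).1
    have h5 := hQ v
    rw [hvr] at h4 h5
    have h6 : Ψ 0 = ∑ i ∈ A, c i * H (u i) := by simp [Ψ]
    rw [h6]
    simp only [Ψ]
    have h7 := mul_le_mul_of_nonneg_left h5 (half_pos hμ).le
    have h8 := mul_lt_mul_of_pos_right hβr hr
    nlinarith
  obtain ⟨v, hv, hmin⟩ := (isCompact_closedBall (0 : κ → ℝ) r).exists_isMinOn_mem_subset
    hΨc.continuousOn (Metric.mem_closedBall_self hr.le) hbd
  refine ⟨v, (mem_ball_zero_iff.1 hv).le, ?_⟩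
  have hloc : IsLocalMin Ψ v := hmin.isLocalMin
    (mem_of_superset (Metric.isOpen_ball.mem_nhds hv) Metric.ball_subset_closedBall)
  -- The `k`-th equation is the vanishing of the derivative of `Ψ` along the `k`-th coordinate
  -- direction.
  funext k
  have hloc' : IsLocalMin (fun s : ℝ => Ψ (v + s • Pi.single k 1)) 0 := by
    have : ContinuousAt (fun s : ℝ => v + s • (Pi.single k 1 : κ → ℝ)) 0 := by fun_prop
    exact IsLocalMin.comp_continuous (g := fun s : ℝ => v + s • (Pi.single k 1 : κ → ℝ))
      (by simpa using hloc) this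
  have hderiv : HasDerivAt (fun s : ℝ => Ψ (v + s • Pi.single k 1))
      (∑ i ∈ A, h (u i + z i ⬝ᵥ v / c i) * z i k - t k) 0 := by
    have e : ∀ w : κ → ℝ, ∀ s : ℝ, w ⬝ᵥ (v + s • Pi.single k 1) = w ⬝ᵥ v + s * w k := by
      intro w s
      rw [dotProduct_add, dotProduct_smul, dotProduct_single_one, smul_eq_mul]
    simp only [Ψ, e]
    have hlin : ∀ α β : ℝ, HasDerivAt (fun s : ℝ => α + s * β) β 0 := fun α β => by
      simpa using ((hasDerivAt_id (0 : ℝ)).mul_const β).const_add α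
    refine (HasDerivAt.fun_sum fun i hi => ?_).sub (hlin _ _)
    have hci := hc i hi
    have h1 : HasDerivAt (fun s : ℝ => u i + (z i ⬝ᵥ v + s * z i k) / c i) (z i k / c i) 0 :=
      ((hlin _ _).div_const _).const_add _
    have h2 := hH (u i + (z i ⬝ᵥ v + 0 * z i k) / c i)
    refine ((HasDerivAt.comp (0 : ℝ) h2 h1).const_mul (c i)).congr_deriv ?_
    field_simp
    simp
  have := hloc'.hasDerivAt_eq_zero hderiv
  simp only [Finset.sum_apply, Pi.smul_apply, smul_eq_mul]
  linarith

/-! ### Design probabilities and the variance of Horvitz–Thompson sums. -/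

namespace SurveyPopulation

variable {p : ℕ} (P : SurveyPopulation p)

theorem sum_design_toReal : ∑ A, (P.design A).toReal = 1 := by
  have h := P.design.tsum_coe
  rw [tsum_fintype] at h
  rw [← ENNReal.toReal_sum fun A _ => P.design.apply_ne_top A, h, ENNReal.toReal_one]

theorem prob_eq_sum_ite (E : Set (Finset (Fin P.N))) [DecidablePred (· ∈ E)] :
    P.prob E = ∑ A, (P.design A).toReal * if A ∈ E then 1 else 0 := by
  unfold prob
  refine Finset.sum_congr rfl fun A _ => ?_
  by_cases h : A ∈ E <;> simp [h]

theorem prob_nonneg (E : Set (Finset (Fin P.N))) : 0 ≤ P.prob E :=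
  Finset.sum_nonneg fun _ _ => Set.indicator_nonneg (fun _ _ => ENNReal.toReal_nonneg) _

theorem prob_mono {E F : Set (Finset (Fin P.N))} (h : E ⊆ F) : P.prob E ≤ P.prob F :=
  Finset.sum_le_sum fun _ _ =>
    Set.indicator_le_indicator_of_subset h (fun _ => ENNReal.toReal_nonneg) _

theorem prob_union_le (E F : Set (Finset (Fin P.N))) : P.prob (E ∪ F) ≤ P.prob E + P.prob F := by
  classical
  simp only [prob_eq_sum_ite, ← Finset.sum_add_distrib, ← mul_add]
  refine Finset.sum_le_sum fun A _ => mul_le_mul_of_nonneg_left ?_ ENNReal.toReal_nonneg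
  by_cases hE : A ∈ E <;> by_cases hF : A ∈ F <;> simp [hE, hF]

theorem prob_iUnion_le {κ : Type*} [Fintype κ] (E : κ → Set (Finset (Fin P.N))) :
    P.prob (⋃ k, E k) ≤ ∑ k, P.prob (E k) := by
  classical
  simp only [prob_eq_sum_ite]
  rw [Finset.sum_comm]
  refine Finset.sum_le_sum fun A _ => ?_
  rw [← Finset.mul_sum]
  refine mul_le_mul_of_nonneg_left ?_ ENNReal.toReal_nonneg
  split_ifs with h
  · obtain ⟨k, hk⟩ := Set.mem_iUnion.1 h
    have : (if A ∈ E k then (1 : ℝ) else 0) ≤ ∑ k, if A ∈ E k then (1 : ℝ) else 0 :=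
      Finset.single_le_sum (f := fun k => if A ∈ E k then (1 : ℝ) else 0)
        (fun k _ => by positivity) (Finset.mem_univ k)
    simpa [hk] using this
  · exact Finset.sum_nonneg fun k _ => by positivity

theorem prob_add_prob_compl (E : Set (Finset (Fin P.N))) : P.prob E + P.prob Eᶜ = 1 := by
  classical
  rw [← P.sum_design_toReal]
  simp only [prob_eq_sum_ite, ← Finset.sum_add_distrib, ← mul_add]
  refine Finset.sum_congr rfl fun A _ => ?_
  by_cases hE : A ∈ E <;> simp [hE]

/-- Chebyshev's inequality under the sampling design. -/
theorem prob_lt_abs_le (f : Finset (Fin P.N) → ℝ) {t : ℝ} (ht : 0 < t) :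
    P.prob {A | t < |f A|} ≤ (∑ A, (P.design A).toReal * f A ^ 2) / t ^ 2 := by
  classical
  rw [le_div_iff₀ (by positivity), prob_eq_sum_ite, Finset.sum_mul]
  refine Finset.sum_le_sum fun A _ => ?_
  rw [mul_assoc]
  refine mul_le_mul_of_nonneg_left ?_ ENNReal.toReal_nonneg
  split_ifs with h
  · rw [one_mul, ← sq_abs (f A)]
    exact pow_le_pow_left₀ ht.le (le_of_lt h) 2
  · simpa using sq_nonneg (f A)

theorem incl₂_self (i : Fin P.N) : P.incl₂ i i = P.incl i := by simp [incl₂, incl]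

/-- For `a = d_i`, `b = d_j` the factors have mean zero, and this is their covariance. -/
theorem sum_design_mul_centered (i j : Fin P.N) (a b : ℝ) :
    ∑ A, (P.design A).toReal * (((if i ∈ A then a else 0) - 1) * ((if j ∈ A then b else 0) - 1)) =
      P.incl₂ i j * (a * b) - P.incl i * a - P.incl j * b + 1 := by
  classical
  conv_rhs => rw [← P.sum_design_toReal]
  rw [incl₂, incl, incl, prob_eq_sum_ite, prob_eq_sum_ite, prob_eq_sum_ite, Finset.sum_mul, Finset.sum_mul, Finset.sum_mul, ← Finset.sum_sub_distrib,
    ← Finset.sum_sub_distrib, ← Finset.sum_add_distrib]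
  refine Finset.sum_congr rfl fun A _ => ?_
  by_cases hi : i ∈ A <;> by_cases hj : j ∈ A <;> simp [hi, hj] <;> ring

/-- The variance of the Horvitz–Thompson estimator of `∑ a_i` is bounded by a multiple of
`∑ a_i²`. -/
theorem sum_design_mul_horvitzThompson_sq_le {c₁ c₂ C : ℝ} (hc₁ : 0 < c₁) (hC : 0 ≤ C)
    (hd : ∀ i, c₁ < P.d i ∧ P.d i < c₂)
    (hΔ : ∀ i j, i ≠ j → (P.N : ℝ) * |P.incl₂ i j - P.incl i * P.incl j| ≤ C)
    (a : Fin P.N → ℝ) :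
    ∑ A, (P.design A).toReal * (∑ i ∈ A, P.d i * a i - ∑ i, a i) ^ 2 ≤
      (c₂ + c₂ ^ 2 * C) * ∑ i, a i ^ 2 := by
  classical
  rcases isEmpty_or_nonempty (Fin P.N) with hE | ⟨⟨i₀⟩⟩
  · have h0 : ∀ A : Finset (Fin P.N), ∑ i ∈ A, P.d i * a i = 0 := fun A =>
      Finset.sum_eq_zero fun i _ => isEmptyElim i
    simp [h0]
  have hN : (0 : ℝ) < P.N := by
    have := i₀.pos
    exact_mod_cast this
  -- A zero inclusion probability would give `d_i = 0⁻¹ = 0`, contrary to `0 < c₁ < d_i`.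
  have hπ : ∀ i, P.incl i * P.d i = 1 := fun i => by
    have h := hc₁.trans (hd i).1
    refine mul_inv_cancel₀ fun h0 => ?_
    rw [d, h0, _root_.inv_zero] at h
    exact lt_irrefl _ h
  have hd0 : ∀ i, 0 ≤ P.d i := fun i => (hc₁.trans (hd i).1).le
  have hexp : ∑ A, (P.design A).toReal * (∑ i ∈ A, P.d i * a i - ∑ i, a i) ^ 2 =
      ∑ i, ∑ j, (a i * a j) * (P.incl₂ i j * (P.d i * P.d j) - 1) := by
    have h1 : ∀ A : Finset (Fin P.N), ∑ i ∈ A, P.d i * a i - ∑ i, a i =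
        ∑ i, ((if i ∈ A then P.d i else 0) - 1) * a i := fun A => by
      simp [sub_mul, Finset.sum_sub_distrib]
    have h2 : ∀ i j, (a i * a j) * (P.incl₂ i j * (P.d i * P.d j) - 1) =
        ∑ A, (P.design A).toReal * ((((if i ∈ A then P.d i else 0) - 1) * a i) *
          (((if j ∈ A then P.d j else 0) - 1) * a j)) := fun i j => by
      have h3 := P.sum_design_mul_centered i j (P.d i) (P.d j)
      rw [hπ, hπ] at h3
      have h4 : P.incl₂ i j * (P.d i * P.d j) - 1 =
        P.incl₂ i j * (P.d i * P.d j) - 1 - 1 + 1 := by ring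
      rw [h4, ← h3, Finset.mul_sum]
      refine Finset.sum_congr rfl fun A _ => by ring
    simp_rw [h1, sq, Finset.sum_mul_sum, h2, Finset.mul_sum]
    rw [Finset.sum_comm]
    refine Finset.sum_congr rfl fun i _ => Finset.sum_comm
  -- The diagonal factor is `d_i - 1 < c₂`; off the diagonal it is `(π_ij - π_i π_j) d_i d_j`, of
  -- order `1 / N`. Cauchy–Schwarz for `(∑ |a_i|)²` gives back the factor `N`.
  have hbound : ∀ i j, (a i * a j) * (P.incl₂ i j * (P.d i * P.d j) - 1) ≤
      (if i = j then c₂ * a i ^ 2 else 0) + c₂ ^ 2 * (C / P.N) * (|a i| * |a j|) := by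
    intro i j
    have hC' : 0 ≤ c₂ ^ 2 * (C / P.N) * (|a i| * |a j|) := by positivity
    split_ifs with hij
    · subst hij
      have h1 : P.incl₂ i i * (P.d i * P.d i) = P.d i := by
        rw [incl₂_self, ← mul_assoc, hπ, one_mul]
      rw [h1]
      have h2 := (hd i).2
      nlinarith [sq_nonneg (a i)]
    · rw [zero_add]
      have h1 : P.incl₂ i j * (P.d i * P.d j) - 1 =
          (P.incl₂ i j - P.incl i * P.incl j) * (P.d i * P.d j) := by
        have : P.incl i * P.incl j * (P.d i * P.d j) = 1 := by
          rw [mul_mul_mul_comm, hπ, hπ, one_mul]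
        rw [sub_mul, this]
      have h2 : |P.incl₂ i j - P.incl i * P.incl j| ≤ C / P.N := by
        rw [le_div_iff₀ hN, mul_comm]
        exact hΔ i j hij
      have h3 : P.d i * P.d j ≤ c₂ ^ 2 := by
        rw [sq]
        exact mul_le_mul (hd i).2.le (hd j).2.le (hd0 j) ((hd0 i).trans (hd i).2.le)
      calc (a i * a j) * (P.incl₂ i j * (P.d i * P.d j) - 1)
          ≤ |(a i * a j) * (P.incl₂ i j * (P.d i * P.d j) - 1)| := le_abs_self _
        _ = (|a i| * |a j|) * (|P.incl₂ i j - P.incl i * P.incl j| * (P.d i * P.d j)) := by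
          rw [h1, abs_mul, abs_mul, abs_mul, abs_of_nonneg (mul_nonneg (hd0 i) (hd0 j))]
        _ ≤ (|a i| * |a j|) * (C / P.N * c₂ ^ 2) := by
          gcongr
          exact mul_nonneg (hd0 i) (hd0 j)
        _ = _ := by ring
  have hcs : (∑ i, |a i|) ^ 2 ≤ P.N * ∑ i, a i ^ 2 := by
    have := sq_sum_le_card_mul_sum_sq (s := Finset.univ) (f := fun i => |a i|)
    simpa using this
  rw [hexp]
  calc _ ≤ ∑ i, ∑ j, ((if i = j then c₂ * a i ^ 2 else 0) +
        c₂ ^ 2 * (C / P.N) * (|a i| * |a j|)) :=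
        Finset.sum_le_sum fun i _ => Finset.sum_le_sum fun j _ => hbound i j
    _ = c₂ * ∑ i, a i ^ 2 + c₂ ^ 2 * (C / P.N) * (∑ i, |a i|) ^ 2 := by
      simp only [Finset.sum_add_distrib, Finset.sum_ite_eq, Finset.mem_univ, if_true,
        ← Finset.mul_sum]
      rw [sq (∑ i, |a i|), Finset.sum_mul]
    _ ≤ c₂ * ∑ i, a i ^ 2 + c₂ ^ 2 * (C / P.N) * (P.N * ∑ i, a i ^ 2) := by gcongr
    _ = _ := by field_simp

theorem prob_lt_abs_horvitzThompson_sub_le {c₁ c₂ C : ℝ} (hc₁ : 0 < c₁) (hC : 0 ≤ C)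
    (hd : ∀ i, c₁ < P.d i ∧ P.d i < c₂)
    (hΔ : ∀ i j, i ≠ j → (P.N : ℝ) * |P.incl₂ i j - P.incl i * P.incl j| ≤ C)
    (a : Fin P.N → ℝ) {t : ℝ} (ht : 0 < t) :
    P.prob {A | t < |∑ i ∈ A, P.d i * a i - ∑ i, a i|} ≤
      (c₂ + c₂ ^ 2 * C) * (∑ i, a i ^ 2) / t ^ 2 :=
  (P.prob_lt_abs_le _ ht).trans
    (div_le_div_of_nonneg_right (P.sum_design_mul_horvitzThompson_sq_le hc₁ hC hd hΔ a)
      (by positivity))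

end SurveyPopulation

/-! ### Calibration on a fixed sample: bounds, optimality, expansion. -/

namespace SurveyPopulation

variable {p : ℕ} (P : SurveyPopulation p)

/-- The squared Euclidean norm of `(y_i, x_i, c_i)`. -/
def normSq (i : Fin P.N) : ℝ := P.y i ^ 2 + (∑ k, P.x i k ^ 2) + P.c i ^ 2

theorem normSq_nonneg (i : Fin P.N) : 0 ≤ P.normSq i := by
  unfold normSq; positivity

theorem abs_y_le_sqrt_normSq (i : Fin P.N) : |P.y i| ≤ √(P.normSq i) := by
  refine Real.abs_le_sqrt ?_
  have : 0 ≤ ∑ k, P.x i k ^ 2 := Finset.sum_nonneg fun k _ => sq_nonneg _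
  unfold normSq
  nlinarith [sq_nonneg (P.c i)]

theorem abs_c_le_sqrt_normSq (i : Fin P.N) : |P.c i| ≤ √(P.normSq i) := by
  refine Real.abs_le_sqrt ?_
  have : 0 ≤ ∑ k, P.x i k ^ 2 := Finset.sum_nonneg fun k _ => sq_nonneg _
  unfold normSq
  nlinarith [sq_nonneg (P.y i)]

theorem abs_x_le_sqrt_normSq (i : Fin P.N) (k : Fin p) : |P.x i k| ≤ √(P.normSq i) := by
  refine Real.abs_le_sqrt ?_
  have : P.x i k ^ 2 ≤ ∑ k, P.x i k ^ 2 :=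
    Finset.single_le_sum (f := fun k => P.x i k ^ 2) (fun k _ => sq_nonneg _) (Finset.mem_univ k)
  unfold normSq
  nlinarith [sq_nonneg (P.y i), sq_nonneg (P.c i)]

variable {P} {G : ℝ → ℝ}

theorem abs_z_le {K : ℝ} (hK : 1 ≤ K) {i : Fin P.N} (hg : |deriv G (P.d i)| ≤ K)
    (k : Fin (p + 1)) : |P.z G i k| ≤ K * √(P.normSq i) := by
  unfold z
  refine Fin.lastCases ?_ (fun k => ?_) k
  · rw [Fin.snoc_last, abs_mul]
    exact mul_le_mul hg (P.abs_c_le_sqrt_normSq i) (abs_nonneg _) (zero_le_one.trans hK)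
  · rw [Fin.snoc_castSucc]
    exact (P.abs_x_le_sqrt_normSq i k).trans (le_mul_of_one_le_left (Real.sqrt_nonneg _) hK)

theorem abs_z_dotProduct_le {K : ℝ} (hK : 1 ≤ K) {i : Fin P.N} (hg : |deriv G (P.d i)| ≤ K)
    (v : Fin (p + 1) → ℝ) : |P.z G i ⬝ᵥ v| ≤ (p + 1) * K * √(P.normSq i) * ‖v‖ := by
  have h0 : 0 ≤ K := zero_le_one.trans hK
  calc |P.z G i ⬝ᵥ v| ≤ ∑ k, |P.z G i k * v k| := Finset.abs_sum_le_sum_abs _ _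
    _ ≤ ∑ _k : Fin (p + 1), K * √(P.normSq i) * ‖v‖ := by
      refine Finset.sum_le_sum fun k _ => ?_
      rw [abs_mul]
      exact mul_le_mul (abs_z_le hK hg k) (norm_le_pi_norm v k) (abs_nonneg _) (by positivity)
    _ = _ := by
      rw [Finset.sum_const, Finset.card_univ, Fintype.card_fin, nsmul_eq_mul]
      push_cast; ring

/-- This is the multiplier at which the Lagrange conditions return the design weights. -/
theorem z_dotProduct_single_last (i : Fin P.N) :
    P.z G i ⬝ᵥ Pi.single (Fin.last p) 1 = deriv G (P.d i) * P.c i := by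
  rw [dotProduct_single_one]
  simp [z]

/-- The benchmarking and debiasing constraints together say `∑_A ω_i z_i = ∑_U z_i`. -/
theorem mem_feasible_iff {V : Set ℝ} {A : Finset (Fin P.N)} {ω : A → ℝ} :
    ω ∈ P.feasible G V A ↔
      (∀ i, ω i ∈ V) ∧ ∑ i : A, ω i • P.z G i = ∑ i, P.z G i := by
  refine and_congr_right fun _ => ⟨fun ⟨h1, h2⟩ => ?_, fun h => ⟨?_, ?_⟩⟩
  · funext k
    refine Fin.lastCases ?_ (fun k => ?_) k
    · simpa [Finset.sum_apply, z] using h2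
    · simpa [Finset.sum_apply, z] using congrFun h1 k
  · funext k
    simpa [Finset.sum_apply, z] using congrFun h k.castSucc
  · simpa [Finset.sum_apply, z] using congrFun h (Fin.last p)

/-- The midpoint of two distinct minimizers would be feasible with a strictly smaller objective. -/
theorem IsCalibrationWeight.eq {V : Set ℝ} (hG : StrictConvexOn ℝ V G) (hc : ∀ i, 0 < P.c i)
    {A : Finset (Fin P.N)} {ω ω' : A → ℝ} (h : P.IsCalibrationWeight G V A ω)
    (h' : P.IsCalibrationWeight G V A ω') : ω = ω' := by
  by_contra hne
  obtain ⟨j, hj⟩ := Function.ne_iff.1 hne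
  have hf := mem_feasible_iff.1 h.1
  have hf' := mem_feasible_iff.1 h'.1
  let w : A → ℝ := fun i => (1 / 2 : ℝ) • ω i + (1 / 2 : ℝ) • ω' i
  have hw : w ∈ P.feasible G V A := by
    refine mem_feasible_iff.2 ⟨fun i => ?_, ?_⟩
    · exact hG.1 (hf.1 i) (hf'.1 i) (by norm_num) (by norm_num) (by norm_num)
    · have : ∀ i : A, w i • P.z G i =
          (1 / 2 : ℝ) • (ω i • P.z G i) + (1 / 2 : ℝ) • (ω' i • P.z G i) := fun i => by
        simp only [w, add_smul, smul_assoc]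
      rw [Finset.sum_congr rfl fun i _ => this i, Finset.sum_add_distrib, ← Finset.smul_sum,
        ← Finset.smul_sum, hf.2, hf'.2, ← add_smul]
      norm_num
  have e1 := h.2 hw
  have e2 := h'.2 hw
  simp only [Set.mem_ofPred_eq] at e1 e2
  have hlt : ∑ i : A, P.c i * G (w i) <
      ∑ i : A, ((1 / 2) * (P.c i * G (ω i)) + (1 / 2) * (P.c i * G (ω' i))) := by
    refine Finset.sum_lt_sum (fun i _ => ?_) ⟨j, Finset.mem_univ j, ?_⟩
    · have := hG.convexOn.2 (hf.1 i) (hf'.1 i) one_half_pos.le one_half_pos.le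
        (add_halves (1 : ℝ))
      have := mul_le_mul_of_nonneg_left this (hc i).le
      simp only [smul_eq_mul] at this
      simp only [w, smul_eq_mul]
      linarith
    · have := hG.2 (hf.1 j) (hf'.1 j) hj one_half_pos one_half_pos (add_halves (1 : ℝ))
      have := mul_lt_mul_of_pos_left this (hc j)
      simp only [smul_eq_mul] at this
      simp only [w, smul_eq_mul]
      linarith
  rw [Finset.sum_add_distrib, ← Finset.mul_sum, ← Finset.mul_sum] at hlt
  linarith

/-- The Karush–Kuhn–Tucker conditions are sufficient for the calibration problem. -/
theorem isCalibrationWeight_of_multiplier {V : Set ℝ} (hG : ConvexOn ℝ V G)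
    (hc : ∀ i, 0 ≤ P.c i) {A : Finset (Fin P.N)} {ω : A → ℝ} (hω : ω ∈ P.feasible G V A)
    (hd : ∀ i, DifferentiableAt ℝ G (ω i)) (l : Fin (p + 1) → ℝ)
    (hl : ∀ i : A, P.c i * deriv G (ω i) = P.z G i ⬝ᵥ l) : P.IsCalibrationWeight G V A ω := by
  refine ⟨hω, fun ω' hω' => ?_⟩
  have hf := mem_feasible_iff.1 hω
  have hf' := mem_feasible_iff.1 hω'
  simp only [Set.mem_ofPred_eq]
  have h1 : ∀ i : A, P.c i * G (ω i) + (ω' i • P.z G i - ω i • P.z G i) ⬝ᵥ l ≤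
      P.c i * G (ω' i) := fun i => by
    have := mul_le_mul_of_nonneg_left
      (hG.add_mul_sub_le_of_hasDerivAt (hf.1 i) (hf'.1 i) (hd i).hasDerivAt) (hc i)
    rw [← sub_smul, smul_dotProduct, ← hl, smul_eq_mul]
    linarith
  -- Both weight vectors have the same total `∑_A ω_i z_i`, so the tangent terms cancel in the sum.
  have h2 := Finset.sum_le_sum fun i (_ : i ∈ Finset.univ) => h1 i
  rw [Finset.sum_add_distrib, ← sum_dotProduct, Finset.sum_sub_distrib, hf.2, hf'.2, sub_self,
    zero_dotProduct, add_zero] at h2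
  exact h2

/-- Weights of the form `h(g(d_i) + z_iᵀ v / c_i)`, with `h` the inverse of `g`, that meet the
constraints are calibration weights. -/
theorem isCalibrationWeight_of_inverse {V : Set ℝ} (hG : ConvexOn ℝ V G)
    (hc : ∀ i, 0 < P.c i) {A : Finset (Fin P.N)} {a b : ℝ} (hab : Set.Icc a b ⊆ V)
    (hd : ∀ w ∈ Set.Icc a b, DifferentiableAt ℝ G w) {h : ℝ → ℝ}
    (hh : ∀ u, h u ∈ Set.Icc a b → deriv G (h u) = u) {v : Fin (p + 1) → ℝ}
    (hv : ∑ i ∈ A, h (deriv G (P.d i) + P.z G i ⬝ᵥ v / P.c i) • P.z G i = ∑ i, P.z G i)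
    (hmem : ∀ i ∈ A, h (deriv G (P.d i) + P.z G i ⬝ᵥ v / P.c i) ∈ Set.Icc a b) :
    P.IsCalibrationWeight G V A fun i => h (deriv G (P.d i) + P.z G i ⬝ᵥ v / P.c i) := by
  -- Here `c_i g(ω_i) = g(d_i) c_i + z_iᵀ v = z_iᵀ (e_last + v)`.
  refine isCalibrationWeight_of_multiplier hG (fun i => (hc i).le)
    (mem_feasible_iff.2 ⟨fun i => hab (hmem i i.2), ?_⟩) (fun i => hd _ (hmem i i.2))
    (v + Pi.single (Fin.last p) 1) fun i => ?_
  · rw [← hv]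
    exact Finset.sum_coe_sort A fun i => h (deriv G (P.d i) + P.z G i ⬝ᵥ v / P.c i) • P.z G i
  · rw [hh _ (hmem i i.2), dotProduct_add, z_dotProduct_single_last]
    have := (hc i).ne'
    field_simp
    ring

/-- By the Cauchy–Schwarz inequality, a lower bound on `∑_A (z_iᵀ v)²` and an upper bound on the
weighted sums `∑_A (z_iᵀ v)² c_i` bound `∑_A (z_iᵀ v)² / c_i` from below. -/
theorem le_sum_sq_div (hc : ∀ i, 0 < P.c i) {A : Finset (Fin P.N)} {Q B : ℝ} (hQ : 0 ≤ Q)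
    (hB : 0 < B) {v : Fin (p + 1) → ℝ} (hlo : Q * ‖v‖ ^ 2 ≤ ∑ i ∈ A, (P.z G i ⬝ᵥ v) ^ 2)
    (hhi : ∑ i ∈ A, (P.z G i ⬝ᵥ v) ^ 2 * P.c i ≤ B * ‖v‖ ^ 2) :
    Q ^ 2 / B * ‖v‖ ^ 2 ≤ ∑ i ∈ A, (P.z G i ⬝ᵥ v) ^ 2 / P.c i := by
  have hnn : 0 ≤ ∑ i ∈ A, (P.z G i ⬝ᵥ v) ^ 2 / P.c i :=
    Finset.sum_nonneg fun i _ => div_nonneg (sq_nonneg _) (hc i).le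
  rcases eq_or_lt_of_le (norm_nonneg v) with h0 | h0
  · rw [← h0]; simpa using hnn
  have hcs := Finset.sum_sq_le_sum_mul_sum_of_sq_le_mul A (r := fun i => (P.z G i ⬝ᵥ v) ^ 2)
    (f := fun i => (P.z G i ⬝ᵥ v) ^ 2 / P.c i) (g := fun i => (P.z G i ⬝ᵥ v) ^ 2 * P.c i)
    (fun i _ => div_nonneg (sq_nonneg _) (hc i).le) (fun i _ => mul_nonneg (sq_nonneg _) (hc i).le)
    (fun i _ => by have := (hc i).ne'; field_simp; rfl)
  have h1 := (pow_le_pow_left₀ (by positivity) hlo 2).trans hcs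
  have h2 := h1.trans (mul_le_mul_of_nonneg_left hhi hnn)
  rw [div_mul_eq_mul_div, div_le_iff₀ hB]
  have h3 : 0 < ‖v‖ ^ 2 := by positivity
  refine le_of_mul_le_mul_right ?_ h3
  linarith

theorem dotProduct_gammaHat_matrix_mulVec (A : Finset (Fin P.N)) (v w : Fin (p + 1) → ℝ) :
    v ⬝ᵥ (∑ i ∈ A, (1 / (deriv (deriv G) (P.d i) * P.c i)) • vecMulVec (P.z G i) (P.z G i)) *ᵥ w =
      ∑ i ∈ A, (P.z G i ⬝ᵥ v) * (P.z G i ⬝ᵥ w) / (deriv (deriv G) (P.d i) * P.c i) := by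
  rw [sum_mulVec, dotProduct_sum]
  refine Finset.sum_congr rfl fun i _ => ?_
  rw [smul_mulVec, dotProduct_smul, vecMulVec_mulVec, dotProduct_smul]
  simp only [smul_eq_mul, MulOpposite.smul_eq_mul_unop, MulOpposite.unop_op]
  rw [dotProduct_comm v]
  ring

/-- The normal equations for `γ̂`. -/
theorem gammaHat_normal_equation {A : Finset (Fin P.N)} {κ : ℝ} (hκ : 0 < κ)
    (hpos : ∀ v : Fin (p + 1) → ℝ, κ * ‖v‖ ^ 2 ≤
      ∑ i ∈ A, (P.z G i ⬝ᵥ v) ^ 2 / (deriv (deriv G) (P.d i) * P.c i)) :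
    (∑ i ∈ A, (1 / (deriv (deriv G) (P.d i) * P.c i)) • vecMulVec (P.z G i) (P.z G i)) *ᵥ
      P.gammaHat G A = ∑ i ∈ A, (P.y i / (deriv (deriv G) (P.d i) * P.c i)) • P.z G i := by
  unfold gammaHat
  set Mt := ∑ i ∈ A, (1 / (deriv (deriv G) (P.d i) * P.c i)) • vecMulVec (P.z G i) (P.z G i)
    with hMt
  -- Positivity of the quadratic form excludes a kernel, so the inverse in `gammaHat` is a true
  -- inverse and not the default value 0.
  have hu : IsUnit Mt := by
    rw [← mulVec_injective_iff_isUnit]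
    refine (injective_iff_map_eq_zero Mt.mulVecLin).2 fun v hv => ?_
    have h1 := dotProduct_gammaHat_matrix_mulVec (G := G) A v v
    rw [← hMt, ← mulVecLin_apply, hv, dotProduct_zero] at h1
    have h2 := hpos v
    simp only [sq (P.z G _ ⬝ᵥ v)] at h2
    rw [← h1] at h2
    have : ‖v‖ ^ 2 ≤ 0 := by nlinarith [sq_nonneg ‖v‖]
    have : ‖v‖ = 0 := pow_eq_zero_iff two_ne_zero |>.1 (le_antisymm this (sq_nonneg _))
    exact norm_eq_zero.1 this
  rw [mulVec_mulVec, mul_nonsing_inv _ ((isUnit_iff_isUnit_det _).1 hu), one_mulVec]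

/-- For weights that meet the constraints, the difference from the regression estimator is the sum
of the residuals weighted with the adjustments of the design weights. -/
theorem sum_mul_y_sub_greg {A : Finset (Fin P.N)} {w : Fin P.N → ℝ}
    (hw : ∑ i ∈ A, w i • P.z G i = ∑ i, P.z G i) (γ : Fin (p + 1) → ℝ) :
    ∑ i ∈ A, w i * P.y i - P.greg G γ A =
      ∑ i ∈ A, (w i - P.d i) * (P.y i - P.z G i ⬝ᵥ γ) := by
  -- Pairing the constraint with `γ` replaces `∑_U z_iᵀ γ` by `∑_A w_i z_iᵀ γ`.
  have h := congrArg (· ⬝ᵥ γ) hw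
  simp only [sum_dotProduct, smul_dotProduct, smul_eq_mul] at h
  unfold greg
  rw [← h, ← sub_sub, ← Finset.sum_sub_distrib, ← Finset.sum_sub_distrib]
  refine Finset.sum_congr rfl fun i _ => ?_
  rw [d]
  ring

/-- Expansion of the calibration estimator with weights close to the design weights. -/
theorem abs_sum_mul_y_sub_greg_le {A : Finset (Fin P.N)} {w : Fin P.N → ℝ}
    (hw : ∑ i ∈ A, w i • P.z G i = ∑ i, P.z G i) (γ v : Fin (p + 1) → ℝ) {K m c₀ κ τ B : ℝ}
    (hK : 1 ≤ K) (hg : ∀ i, |deriv G (P.d i)| ≤ K) (hm : 0 < m)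
    (hm' : ∀ i, m ≤ deriv (deriv G) (P.d i)) (hc₀ : 0 < c₀) (hc : ∀ i, c₀ ≤ P.c i) (hκ : 0 < κ)
    (hpos : ∀ v : Fin (p + 1) → ℝ, κ * ‖v‖ ^ 2 ≤
      ∑ i ∈ A, (P.z G i ⬝ᵥ v) ^ 2 / (deriv (deriv G) (P.d i) * P.c i)) (hτ : 0 ≤ τ)
    (hrem : ∀ i ∈ A, |w i - P.d i - P.z G i ⬝ᵥ v / (deriv (deriv G) (P.d i) * P.c i)| ≤
      τ * |P.z G i ⬝ᵥ v|) (hB : ∑ i, P.normSq i ≤ B) :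
    |∑ i ∈ A, w i * P.y i - P.greg G γ A| ≤ B * ‖v‖ *
      (((p + 1) * K) ^ 2 / (m * c₀) * ‖P.gammaHat G A - γ‖ +
        τ * ((p + 1) * K * (1 + (p + 1) * K * ‖γ‖))) := by
  set D : ℝ := (p + 1) * K with hD
  have hD0 : 0 ≤ D := by positivity
  have hBA : ∑ i ∈ A, P.normSq i ≤ B :=
    (Finset.sum_le_univ_sum_of_nonneg fun i => P.normSq_nonneg i).trans hB
  have hdot : ∀ i u, |P.z G i ⬝ᵥ u| ≤ D * √(P.normSq i) * ‖u‖ :=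
    fun i u => abs_z_dotProduct_le hK (hg i) u
  have hsq : ∀ i, √(P.normSq i) * √(P.normSq i) = P.normSq i :=
    fun i => Real.mul_self_sqrt (P.normSq_nonneg i)
  -- With `M` the matrix inverted in `γ̂`, the normal equations give `∑ z_i y_i / (g'(d_i) c_i) = M
  -- γ̂`; the linear part is therefore `vᵀ M (γ̂ - γ)`.
  have hmain : ∑ i ∈ A, P.z G i ⬝ᵥ v / (deriv (deriv G) (P.d i) * P.c i) *
      (P.y i - P.z G i ⬝ᵥ γ) = ∑ i ∈ A, (P.z G i ⬝ᵥ v) * (P.z G i ⬝ᵥ (P.gammaHat G A - γ)) /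
        (deriv (deriv G) (P.d i) * P.c i) := by
    rw [← dotProduct_gammaHat_matrix_mulVec, mulVec_sub, dotProduct_sub,
      gammaHat_normal_equation hκ hpos, dotProduct_gammaHat_matrix_mulVec, dotProduct_sum,
      ← Finset.sum_sub_distrib]
    refine Finset.sum_congr rfl fun i _ => ?_
    rw [dotProduct_smul, smul_eq_mul, dotProduct_comm v]
    ring
  have hsplit : ∑ i ∈ A, w i * P.y i - P.greg G γ A =
      ∑ i ∈ A, (P.z G i ⬝ᵥ v) * (P.z G i ⬝ᵥ (P.gammaHat G A - γ)) /
        (deriv (deriv G) (P.d i) * P.c i) +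
      ∑ i ∈ A, (w i - P.d i - P.z G i ⬝ᵥ v / (deriv (deriv G) (P.d i) * P.c i)) *
        (P.y i - P.z G i ⬝ᵥ γ) := by
    rw [sum_mul_y_sub_greg hw, ← hmain, ← Finset.sum_add_distrib]
    exact Finset.sum_congr rfl fun i _ => by ring
  have h1 : |∑ i ∈ A, (P.z G i ⬝ᵥ v) * (P.z G i ⬝ᵥ (P.gammaHat G A - γ)) /
        (deriv (deriv G) (P.d i) * P.c i)| ≤
      B * ‖v‖ * (D ^ 2 / (m * c₀) * ‖P.gammaHat G A - γ‖) := by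
    calc _ ≤ ∑ i ∈ A, P.normSq i * (‖v‖ * (D ^ 2 / (m * c₀) * ‖P.gammaHat G A - γ‖)) := by
          refine (Finset.abs_sum_le_sum_abs _ _).trans (Finset.sum_le_sum fun i _ => ?_)
          have hden : m * c₀ ≤ deriv (deriv G) (P.d i) * P.c i :=
            mul_le_mul (hm' i) (hc i) hc₀.le (hm.le.trans (hm' i))
          have hden0 : 0 < m * c₀ := mul_pos hm hc₀
          rw [abs_div, abs_mul, abs_of_pos (hden0.trans_le hden)]
          calc _ ≤ (D * √(P.normSq i) * ‖v‖) * (D * √(P.normSq i) * ‖P.gammaHat G A - γ‖) /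
                (m * c₀) := by
                gcongr
                · exact hdot i v
                · exact hdot i _
            _ = _ := by
              rw [← hsq i]
              simp only [Real.sqrt_mul_self (Real.sqrt_nonneg _)]
              ring
      _ ≤ _ := by
        rw [← Finset.sum_mul, mul_assoc B]
        exact mul_le_mul_of_nonneg_right hBA (by positivity)
  have h2 : |∑ i ∈ A, (w i - P.d i - P.z G i ⬝ᵥ v / (deriv (deriv G) (P.d i) * P.c i)) *
        (P.y i - P.z G i ⬝ᵥ γ)| ≤ B * ‖v‖ * (τ * (D * (1 + D * ‖γ‖))) := by
    calc _ ≤ ∑ i ∈ A, P.normSq i * (‖v‖ * (τ * (D * (1 + D * ‖γ‖)))) := by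
          refine (Finset.abs_sum_le_sum_abs _ _).trans (Finset.sum_le_sum fun i hi => ?_)
          have hy : |P.y i - P.z G i ⬝ᵥ γ| ≤ √(P.normSq i) * (1 + D * ‖γ‖) := by
            refine (abs_sub _ _).trans ?_
            have := hdot i γ
            have := P.abs_y_le_sqrt_normSq i
            linarith
          rw [abs_mul]
          calc _ ≤ (τ * (D * √(P.normSq i) * ‖v‖)) * (√(P.normSq i) * (1 + D * ‖γ‖)) := by
                refine mul_le_mul ((hrem i hi).trans ?_) hy (abs_nonneg _) (by positivity)
                exact mul_le_mul_of_nonneg_left (hdot i v) hτ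
            _ = (√(P.normSq i) * √(P.normSq i)) * (‖v‖ * (τ * (D * (1 + D * ‖γ‖)))) := by ring
            _ = _ := by rw [hsq]
      _ ≤ _ := by
        rw [← Finset.sum_mul, mul_assoc B]
        exact mul_le_mul_of_nonneg_right hBA (by positivity)
  rw [hsplit, mul_add]
  exact (abs_add_le _ _).trans (add_le_add h1 h2)

end SurveyPopulation

/-! ### Uniform constants from compactness. -/

/-- Compact neighbourhood of `[c₁, c₂]` on which the derivatives of `G` are controlled. -/
theorem exists_Icc_deriv_bounds {G : ℝ → ℝ} {V : Set ℝ} (hV : Convex ℝ V)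
    (hGdiff : ContDiffOn ℝ 2 G V) (hg' : ∀ w ∈ interior V, 0 < deriv (deriv G) w) {c₁ c₂ : ℝ}
    (hc₁V : c₁ ∈ interior V) (hc₂V : c₂ ∈ interior V) (h12 : c₁ ≤ c₂) :
    ∃ a b m M K : ℝ, a < c₁ ∧ c₂ < b ∧ Set.Icc a b ⊆ V ∧ 0 < m ∧ 0 < M ∧ 1 ≤ K ∧
      (∀ w ∈ Set.Icc a b, DifferentiableAt ℝ G w) ∧
      (∀ w ∈ Set.Icc a b, DifferentiableAt ℝ (deriv G) w) ∧
      (∀ w ∈ Set.Icc a b, m ≤ deriv (deriv G) w) ∧ (∀ w ∈ Set.Icc a b, deriv (deriv G) w ≤ M) ∧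
      (∀ w ∈ Set.Icc a b, |deriv G w| ≤ K) ∧ ContinuousOn (deriv (deriv G)) (Set.Icc a b) := by
  obtain ⟨e₁, he₁, hb₁⟩ := Metric.isOpen_iff.1 isOpen_interior c₁ hc₁V
  obtain ⟨e₂, he₂, hb₂⟩ := Metric.isOpen_iff.1 isOpen_interior c₂ hc₂V
  have ha : c₁ - e₁ / 2 ∈ interior V := hb₁ (by
    rw [Metric.mem_ball, Real.dist_eq, sub_sub_cancel_left, abs_neg, abs_of_pos (half_pos he₁)]
    exact half_lt_self he₁)
  have hb : c₂ + e₂ / 2 ∈ interior V := hb₂ (by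
    rw [Metric.mem_ball, Real.dist_eq, add_sub_cancel_left, abs_of_pos (half_pos he₂)]
    exact half_lt_self he₂)
  have hsub : Set.Icc (c₁ - e₁ / 2) (c₂ + e₂ / 2) ⊆ interior V := hV.interior.ordConnected.out ha hb
  have hG2 : ContDiffOn ℝ (1 + 1) G (interior V) := by
    rw [one_add_one_eq_two]
    exact hGdiff.mono interior_subset
  obtain ⟨hd0, -, hG1⟩ := (contDiffOn_succ_iff_deriv_of_isOpen isOpen_interior).1 hG2
  have hd1 := hG1.differentiableOn one_ne_zero
  have hcont := hG1.continuousOn_deriv_of_isOpen isOpen_interior le_rfl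
  have hcont' := hcont.mono hsub
  have hne : (Set.Icc (c₁ - e₁ / 2) (c₂ + e₂ / 2)).Nonempty := Set.nonempty_Icc.2 (by linarith)
  obtain ⟨w₁, hw₁, hmin⟩ := isCompact_Icc.exists_isMinOn hne hcont'
  obtain ⟨w₂, hw₂, hmax⟩ := isCompact_Icc.exists_isMaxOn hne hcont'
  obtain ⟨w₃, hw₃, hmaxg⟩ := isCompact_Icc.exists_isMaxOn hne (hd1.continuousOn.mono hsub).abs
  refine ⟨_, _, deriv (deriv G) w₁, deriv (deriv G) w₂, max 1 |deriv G w₃|, by linarith, by linarith,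
    hsub.trans interior_subset, hg' _ (hsub hw₁), hg' _ (hsub hw₂), le_max_left _ _,
    fun w hw => hd0.differentiableAt (isOpen_interior.mem_nhds (hsub hw)),
    fun w hw => hd1.differentiableAt (isOpen_interior.mem_nhds (hsub hw)),
    fun w hw => hmin hw, fun w hw => hmax hw, fun w hw => (hmaxg hw).trans (le_max_right _ _), hcont'⟩

/-- First-order expansion of the inverse of a function whose derivative varies by at most `η`. -/
theorem abs_sub_sub_div_deriv_le {g : ℝ → ℝ} {a b m η x y : ℝ} (hm : 0 < m)
    (hg : ∀ w ∈ Set.Icc a b, DifferentiableAt ℝ g w) (hx : x ∈ Set.Icc a b) (hy : y ∈ Set.Icc a b)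
    (hmx : m ≤ deriv g x)
    (hη : ∀ w ∈ Set.Icc a b, |w - x| ≤ |y - x| → |deriv g w - deriv g x| ≤ η) :
    |y - x - (g y - g x) / deriv g x| ≤ η / m * |y - x| := by
  -- Mean value inequality for `w ↦ g w - g'(x) w`, whose derivative is at most `η` in absolute
  -- value between `x` and `y`.
  have h := (convex_uIcc x y).norm_image_sub_le_of_norm_hasDerivWithin_le
    (f := fun w => g w - deriv g x * w) (f' := fun w => deriv g w - deriv g x) (C := η)
    (x := x) (y := y) (fun w hw => ?_) (fun w hw => ?_) Set.left_mem_uIcc Set.right_mem_uIcc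
  · have hp := hm.trans_le hmx
    have e : y - x - (g y - g x) / deriv g x =
        -(((g y - deriv g x * y) - (g x - deriv g x * x)) / deriv g x) := by
      field_simp
      ring
    rw [Real.norm_eq_abs, Real.norm_eq_abs] at h
    rw [e, abs_neg, abs_div, abs_of_pos hp]
    have hη0 : 0 ≤ η * |y - x| := (abs_nonneg _).trans h
    calc _ ≤ η * |y - x| / deriv g x := by gcongr
      _ ≤ η * |y - x| / m := div_le_div_of_nonneg_left hη0 hm hmx
      _ = _ := by ring
  · have hw' : w ∈ Set.Icc a b := Set.ordConnected_Icc.uIcc_subset hx hy hw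
    have := (hg w hw').hasDerivAt.sub ((hasDerivAt_id w).const_mul (deriv g x))
    rw [mul_one] at this
    exact this.hasDerivWithinAt
  · exact hη w (Set.ordConnected_Icc.uIcc_subset hx hy hw) (by
      rw [abs_sub_comm, abs_sub_comm y]
      have := Set.abs_sub_left_of_mem_uIcc hw
      rwa [abs_sub_comm, abs_sub_comm x])

/-- Matrices close to a positive definite matrix are uniformly positive definite. -/
theorem Matrix.PosDef.exists_forall_le_dotProduct {κ : Type*} [Fintype κ] {S : Matrix κ κ ℝ}
    (hS : S.PosDef) : ∃ q ρ : ℝ, 0 < q ∧ 0 < ρ ∧ ∀ T : Matrix κ κ ℝ,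
      (∀ k l, |T k l - S k l| ≤ ρ) → ∀ v : κ → ℝ, q * ‖v‖ ^ 2 ≤ v ⬝ᵥ T *ᵥ v := by
  classical
  have hlow : ∃ q : ℝ, 0 < q ∧ ∀ v : κ → ℝ, q * ‖v‖ ^ 2 ≤ v ⬝ᵥ S *ᵥ v := by
    rcases (Metric.sphere (0 : κ → ℝ) 1).eq_empty_or_nonempty with he | hne
    · refine ⟨1, one_pos, fun v => ?_⟩
      rcases eq_or_ne v 0 with rfl | hv
      · simp
      · exfalso
        have : ‖v‖⁻¹ • v ∈ Metric.sphere (0 : κ → ℝ) 1 := by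
          rw [mem_sphere_zero_iff_norm, norm_smul, norm_inv, norm_norm,
            inv_mul_cancel₀ (norm_ne_zero_iff.2 hv)]
        rw [he] at this
        exact this
    · have hcont : Continuous fun v : κ → ℝ => v ⬝ᵥ S *ᵥ v := by
        unfold dotProduct mulVec dotProduct
        fun_prop
      obtain ⟨w, hw, hmin⟩ := (isCompact_sphere (0 : κ → ℝ) 1).exists_isMinOn hne hcont.continuousOn
      have hw0 : w ≠ 0 := by
        rintro rfl
        simp at hw
      have hpos := hS.dotProduct_mulVec_pos hw0
      rw [star_trivial] at hpos
      refine ⟨_, hpos, fun v => ?_⟩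
      rcases eq_or_ne v 0 with rfl | hv
      · simp
      · have hn := norm_ne_zero_iff.2 hv
        have hv' : ‖v‖⁻¹ • v ∈ Metric.sphere (0 : κ → ℝ) 1 := by
          rw [mem_sphere_zero_iff_norm, norm_smul, norm_inv, norm_norm, inv_mul_cancel₀ hn]
        have h1 : w ⬝ᵥ S *ᵥ w ≤ (‖v‖⁻¹ • v) ⬝ᵥ S *ᵥ (‖v‖⁻¹ • v) := hmin hv'
        rw [mulVec_smul, smul_dotProduct, dotProduct_smul, smul_eq_mul, smul_eq_mul] at h1
        have h2 := mul_le_mul_of_nonneg_right h1 (sq_nonneg ‖v‖)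
        refine h2.trans_eq ?_
        field_simp
  obtain ⟨q, hq, hqS⟩ := hlow
  obtain ⟨n, hn⟩ : ∃ n : ℝ, n = (Fintype.card κ : ℝ) := ⟨_, rfl⟩
  -- In the sup norm, an entrywise error `ρ` changes the form by at most `n² ρ ‖v‖²`, here at most
  -- half of `q ‖v‖²`. The `+ 1` covers an empty index type.
  refine ⟨q / 2, q / (2 * (n ^ 2 + 1)), half_pos hq, by positivity, fun T hT v => ?_⟩
  have h1 : |v ⬝ᵥ (T - S) *ᵥ v| ≤ q / (2 * (n ^ 2 + 1)) * n ^ 2 * ‖v‖ ^ 2 := by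
    calc |v ⬝ᵥ (T - S) *ᵥ v| = |∑ k, ∑ l, v k * ((T - S) k l * v l)| := by
          simp only [dotProduct, mulVec, Finset.mul_sum]
      _ ≤ ∑ _k : κ, ∑ _l : κ, ‖v‖ * (q / (2 * (n ^ 2 + 1)) * ‖v‖) := by
          refine (Finset.abs_sum_le_sum_abs _ _).trans (Finset.sum_le_sum fun k _ => ?_)
          refine (Finset.abs_sum_le_sum_abs _ _).trans (Finset.sum_le_sum fun l _ => ?_)
          rw [abs_mul, abs_mul]
          exact mul_le_mul (norm_le_pi_norm v k) (mul_le_mul (hT k l) (norm_le_pi_norm v l)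
            (abs_nonneg _) (by positivity)) (by positivity) (norm_nonneg _)
      _ = _ := by
          simp only [Finset.sum_const, Finset.card_univ, nsmul_eq_mul, ← hn]
          ring
  have h2 : q / (2 * (n ^ 2 + 1)) * n ^ 2 ≤ q / 2 := by
    rw [div_mul_eq_mul_div, div_le_div_iff₀ (by positivity) two_pos]
    nlinarith
  have h3 := mul_le_mul_of_nonneg_right h2 (sq_nonneg ‖v‖)
  have h4 := (abs_le.1 h1).1
  rw [sub_mulVec, dotProduct_sub] at h4
  have h5 := hqS v
  linarith

/-! ### Good samples: consequences and probability. -/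

namespace SurveyPopulation

variable {p : ℕ} (P : SurveyPopulation p) {G : ℝ → ℝ}

/-- Samples for which the Horvitz–Thompson estimator of `∑_U z_i` has error at most `B √N`, and
the quadratic form `∑_A (z_iᵀ v)²` is at least `κ N ‖v‖²`. -/
def goodSamples (G : ℝ → ℝ) (κ B : ℝ) : Set (Finset (Fin P.N)) :=
  {A | (∀ k, |∑ i ∈ A, P.d i * P.z G i k - ∑ i, P.z G i k| ≤ B * √P.N) ∧
    ∀ v : Fin (p + 1) → ℝ, κ * P.N * ‖v‖ ^ 2 ≤ ∑ i ∈ A, (P.z G i ⬝ᵥ v) ^ 2}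

variable {P}

theorem sum_normSq_le {C : ℝ} (hC : ∑ i, P.normSq i ^ 2 ≤ C * P.N) :
    ∑ i, P.normSq i ≤ (1 + C) * P.N := by
  calc ∑ i, P.normSq i ≤ ∑ i, (1 + P.normSq i ^ 2) :=
        Finset.sum_le_sum fun i _ => by nlinarith [sq_nonneg (P.normSq i - 1)]
    _ = P.N + ∑ i, P.normSq i ^ 2 := by simp [Finset.sum_add_distrib]
    _ ≤ _ := by linarith

/-- With `s_i = normSq i`, `(z_iᵀ v)²` is at most a multiple of `s_i ‖v‖²` and `c_i ≤ 1 + s_i`; the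
fourth-moment bound controls `∑ (s_i + s_i²)`. -/
theorem sum_sq_mul_c_le {C K : ℝ} (hC : ∑ i, P.normSq i ^ 2 ≤ C * P.N) (hK : 1 ≤ K)
    (hg : ∀ i, |deriv G (P.d i)| ≤ K) (hc : ∀ i, 0 < P.c i) (A : Finset (Fin P.N))
    (v : Fin (p + 1) → ℝ) :
    ∑ i ∈ A, (P.z G i ⬝ᵥ v) ^ 2 * P.c i ≤ ((p + 1) * K) ^ 2 * (1 + 2 * C) * P.N * ‖v‖ ^ 2 := by
  have h1 : ∀ i, (P.z G i ⬝ᵥ v) ^ 2 * P.c i ≤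
      ((p + 1) * K) ^ 2 * ‖v‖ ^ 2 * (P.normSq i + P.normSq i ^ 2) := fun i => by
    have hq := P.normSq_nonneg i
    have e1 : (P.z G i ⬝ᵥ v) ^ 2 ≤ ((p + 1) * K) ^ 2 * ‖v‖ ^ 2 * P.normSq i := by
      rw [← sq_abs]
      refine (pow_le_pow_left₀ (abs_nonneg _) (abs_z_dotProduct_le hK (hg i) v) 2).trans_eq ?_
      rw [mul_pow, mul_pow, Real.sq_sqrt hq]
      ring
    have e2 : P.c i ≤ 1 + P.normSq i := by
      have := (le_abs_self _).trans (P.abs_c_le_sqrt_normSq i)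
      nlinarith [Real.sq_sqrt hq, sq_nonneg (√(P.normSq i) - 1)]
    calc _ ≤ (((p + 1) * K) ^ 2 * ‖v‖ ^ 2 * P.normSq i) * (1 + P.normSq i) :=
          mul_le_mul e1 e2 (hc i).le (by positivity)
      _ = _ := by ring
  calc _ ≤ ∑ i, (P.z G i ⬝ᵥ v) ^ 2 * P.c i :=
        Finset.sum_le_univ_sum_of_nonneg fun i => mul_nonneg (sq_nonneg _) (hc i).le
    _ ≤ ∑ i, ((p + 1) * K) ^ 2 * ‖v‖ ^ 2 * (P.normSq i + P.normSq i ^ 2) :=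
        Finset.sum_le_sum fun i _ => h1 i
    _ = ((p + 1) * K) ^ 2 * ‖v‖ ^ 2 * (∑ i, P.normSq i + ∑ i, P.normSq i ^ 2) := by
        rw [← Finset.mul_sum, Finset.sum_add_distrib]
    _ ≤ ((p + 1) * K) ^ 2 * ‖v‖ ^ 2 * ((1 + C) * P.N + C * P.N) :=
        mul_le_mul_of_nonneg_left (add_le_add (sum_normSq_le hC) hC) (by positivity)
    _ = _ := by ring

/-- On the empty sample the quadratic form vanishes. It has to be excluded because the rate
`n^{-1/2} N` takes the default value 0 there. -/
theorem nonempty_of_mem_goodSamples {κ B : ℝ} (hκ : 0 < κ) (hN : 0 < P.N)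
    {A : Finset (Fin P.N)} (hA : A ∈ P.goodSamples G κ B) : A.Nonempty := by
  by_contra h
  rw [Finset.not_nonempty_iff_eq_empty] at h
  have h1 := hA.2 1
  have h2 : (0 : ℝ) < P.N := by exact_mod_cast hN
  have h3 : 0 < κ * P.N * ‖(1 : Fin (p + 1) → ℝ)‖ ^ 2 := by
    have : 0 < ‖(1 : Fin (p + 1) → ℝ)‖ := norm_pos_iff.2 one_ne_zero
    positivity
  rw [h, Finset.sum_empty] at h1
  linarith

/-- The `c_i` have no uniform upper bound, only moments, so the curvature bound comes from
Cauchy–Schwarz against `∑ (z_iᵀ v)² c_i`. -/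
theorem le_sum_sq_div_of_mem_goodSamples {κ B C K : ℝ} (hκ : 0 < κ) (hN : 0 < P.N)
    (hC0 : 0 ≤ C) (hC : ∑ i, P.normSq i ^ 2 ≤ C * P.N) (hK : 1 ≤ K)
    (hg : ∀ i, |deriv G (P.d i)| ≤ K) (hc : ∀ i, 0 < P.c i) {A : Finset (Fin P.N)}
    (hA : A ∈ P.goodSamples G κ B) (v : Fin (p + 1) → ℝ) :
    κ ^ 2 / (((p + 1) * K) ^ 2 * (1 + 2 * C)) * P.N * ‖v‖ ^ 2 ≤
      ∑ i ∈ A, (P.z G i ⬝ᵥ v) ^ 2 / P.c i := by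
  have hN' : (0 : ℝ) < P.N := by exact_mod_cast hN
  have hK0 : 0 < K := one_pos.trans_le hK
  have hB : 0 < ((p + 1) * K) ^ 2 * (1 + 2 * C) * P.N := by positivity
  refine le_of_eq_of_le ?_
    (le_sum_sq_div hc (by positivity) hB (hA.2 v) (sum_sq_mul_c_le hC hK hg hc A v))
  field_simp

/-- On good samples of large populations the dual equation is solvable near the origin. -/
theorem exists_solution_of_mem_goodSamples {κ B C K c₀ μ L R s δ : ℝ} (hκ : 0 < κ) (hN : 0 < P.N)
    (hC0 : 0 ≤ C) (hC : ∑ i, P.normSq i ^ 2 ≤ C * P.N) (hK : 1 ≤ K)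
    (hg : ∀ i, |deriv G (P.d i)| ≤ K) (hc₀ : 0 < c₀) (hc : ∀ i, c₀ ≤ P.c i)
    {h : ℝ → ℝ} (hcont : Continuous h) (hμ : 0 < μ) (hL : 0 ≤ L)
    (hmono : ∀ u v, u ≤ v → μ * (v - u) ≤ h v - h u) (hlip : ∀ u v, |h u - h v| ≤ L * |u - v|)
    (hhg : ∀ i, h (deriv G (P.d i)) = P.d i) (hR : 0 < R)
    (hRB : 2 * ((p + 1) * B) < μ * (κ ^ 2 / (((p + 1) * K) ^ 2 * (1 + 2 * C))) * R)
    (hs : ∀ i, √(P.normSq i) ≤ s * √P.N) (hδ : L * ((p + 1) * K * s * R / c₀) ≤ δ)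
    {A : Finset (Fin P.N)} (hA : A ∈ P.goodSamples G κ B) :
    ∃ v : Fin (p + 1) → ℝ, ‖v‖ ≤ R / √P.N ∧
      ∑ i ∈ A, h (deriv G (P.d i) + P.z G i ⬝ᵥ v / P.c i) • P.z G i = ∑ i, P.z G i ∧
      (∀ i ∈ A, |h (deriv G (P.d i) + P.z G i ⬝ᵥ v / P.c i) - P.d i| ≤ δ) ∧
      ∀ i ∈ A, |h (deriv G (P.d i) + P.z G i ⬝ᵥ v / P.c i) - P.d i| ≤
        L / c₀ * |P.z G i ⬝ᵥ v| := by
  have hN' : (0 : ℝ) < P.N := by exact_mod_cast hN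
  have hsN : 0 < √(P.N : ℝ) := Real.sqrt_pos.2 hN'
  have hcp : ∀ i, 0 < P.c i := fun i => hc₀.trans_le (hc i)
  have hK0 : 0 < K := one_pos.trans_le hK
  -- As `h(g(d_i)) = d_i`, the defect at `v = 0` is the Horvitz–Thompson error.
  have hdefect : ∀ v : Fin (p + 1) → ℝ,
      |(∑ i ∈ A, h (deriv G (P.d i)) • P.z G i - ∑ i, P.z G i) ⬝ᵥ v| ≤
        (p + 1) * B * √P.N * ‖v‖ := fun v => by
    calc _ ≤ ∑ k, |(∑ i ∈ A, h (deriv G (P.d i)) • P.z G i - ∑ i, P.z G i) k * v k| :=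
          Finset.abs_sum_le_sum_abs _ _
      _ ≤ ∑ _k : Fin (p + 1), B * √P.N * ‖v‖ := by
          refine Finset.sum_le_sum fun k _ => ?_
          rw [abs_mul]
          have h1 := hA.1 k
          refine mul_le_mul ?_ (norm_le_pi_norm v k) (abs_nonneg _) ((abs_nonneg _).trans h1)
          simpa [hhg] using h1
      _ = _ := by
          rw [Finset.sum_const, Finset.card_univ, Fintype.card_fin, nsmul_eq_mul]
          push_cast; ring
  -- Curvature `N` times radius `R / √N` has the order `√N` of the defect, so `R` need not depend on
  -- `N`.
  have hradius : 2 * ((p + 1) * B * √P.N) <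
      μ * (κ ^ 2 / (((p + 1) * K) ^ 2 * (1 + 2 * C)) * P.N) * (R / √P.N) := by
    have h1 : μ * (κ ^ 2 / (((p + 1) * K) ^ 2 * (1 + 2 * C)) * P.N) * (R / √P.N) =
        μ * (κ ^ 2 / (((p + 1) * K) ^ 2 * (1 + 2 * C))) * R * √P.N := by
      have : (P.N : ℝ) = √P.N * √P.N := (Real.mul_self_sqrt hN'.le).symm
      calc _ = μ * (κ ^ 2 / (((p + 1) * K) ^ 2 * (1 + 2 * C))) * R * (P.N / √P.N) := by ring
        _ = _ := by rw [Real.div_sqrt]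
    rw [h1, ← mul_assoc]
    exact mul_lt_mul_of_pos_right hRB hsN
  obtain ⟨v, hv, hsol⟩ := exists_solution_estimatingEquation A (P.z G) P.c
    (fun i => deriv G (P.d i)) (fun i _ => hcp i) (∑ i, P.z G i) hcont hμ hmono
    (fun v => le_sum_sq_div_of_mem_goodSamples hκ hN hC0 hC hK hg hcp hA v) hdefect
    (div_pos hR hsN) hradius
  have hlin : ∀ i, |h (deriv G (P.d i) + P.z G i ⬝ᵥ v / P.c i) - P.d i| ≤
      L / c₀ * |P.z G i ⬝ᵥ v| := fun i => by
    have h1 := hlip (deriv G (P.d i) + P.z G i ⬝ᵥ v / P.c i) (deriv G (P.d i))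
    rw [hhg, add_sub_cancel_left, abs_div, abs_of_pos (hcp i)] at h1
    refine h1.trans ?_
    rw [div_mul_eq_mul_div, mul_div_assoc]
    exact mul_le_mul_of_nonneg_left
      (div_le_div_of_nonneg_left (abs_nonneg _) hc₀ (hc i)) hL
  refine ⟨v, hv, hsol, fun i _ => (hlin i).trans (le_trans ?_ hδ), fun i _ => hlin i⟩
  have h2 : |P.z G i ⬝ᵥ v| ≤ (p + 1) * K * s * R := by
    refine (abs_z_dotProduct_le hK (hg i) v).trans ?_
    calc _ ≤ (p + 1) * K * (s * √P.N) * (R / √P.N) := by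
          have hs0 := (Real.sqrt_nonneg _).trans (hs i)
          gcongr
          exact hs i
      _ = _ := by field_simp
  calc _ ≤ L / c₀ * ((p + 1) * K * s * R) := mul_le_mul_of_nonneg_left h2 (by positivity)
    _ = _ := by ring

end SurveyPopulation

namespace SurveyPopulation

variable {p : ℕ} {P : SurveyPopulation p} {G : ℝ → ℝ}

/-- One term of the fourth-moment sum is at most `C N`, so each norm is `O(N^{1/4})`, hence below `s
√N` once `N ≥ C / s⁴`. -/
theorem sqrt_normSq_le_mul_sqrt {C s : ℝ} (hC : ∑ i, P.normSq i ^ 2 ≤ C * P.N) (hs : 0 < s)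
    (hN : C / s ^ 4 ≤ P.N) (i : Fin P.N) : √(P.normSq i) ≤ s * √P.N := by
  have h1 : P.normSq i ^ 2 ≤ (s ^ 2 * P.N) ^ 2 := by
    have e1 : P.normSq i ^ 2 ≤ ∑ i, P.normSq i ^ 2 :=
      Finset.single_le_sum (f := fun i => P.normSq i ^ 2) (fun _ _ => sq_nonneg _)
        (Finset.mem_univ i)
    rw [div_le_iff₀ (by positivity)] at hN
    have e2 := mul_le_mul_of_nonneg_right hN (Nat.cast_nonneg (α := ℝ) P.N)
    nlinarith
  have h2 : P.normSq i ≤ s ^ 2 * P.N := le_of_sq_le_sq h1 (by positivity)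
  refine (Real.sqrt_le_sqrt h2).trans_eq ?_
  rw [Real.sqrt_mul (by positivity), Real.sqrt_sq hs.le]

/-- Good samples have high probability in large populations. -/
theorem prob_compl_goodSamples_le {c₁ c₂ CΔ C K q ρ B : ℝ} (hc₁ : 0 < c₁) (hCΔ : 0 ≤ CΔ)
    (hd : ∀ i, c₁ < P.d i ∧ P.d i < c₂)
    (hΔ : ∀ i j, i ≠ j → (P.N : ℝ) * |P.incl₂ i j - P.incl i * P.incl j| ≤ CΔ)
    (hC : ∑ i, P.normSq i ^ 2 ≤ C * P.N) (hK : 1 ≤ K)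
    (hg : ∀ i, |deriv G (P.d i)| ≤ K) (hN : 0 < P.N) (hc₂ : 0 < c₂)
    {S : Matrix (Fin (p + 1)) (Fin (p + 1)) ℝ} (hρ : 0 < ρ)
    (hq : ∀ T : Matrix (Fin (p + 1)) (Fin (p + 1)) ℝ, (∀ k l, |T k l - S k l| ≤ ρ) →
      ∀ v : Fin (p + 1) → ℝ, q * ‖v‖ ^ 2 ≤ v ⬝ᵥ T *ᵥ v)
    (hS : ∀ k l, |(P.N : ℝ)⁻¹ * ∑ i, P.z G i k * P.z G i l - S k l| ≤ ρ / 2) (hB : 0 < B) :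
    P.prob (P.goodSamples G (q / c₂) B)ᶜ ≤
      (p + 1) * (c₂ + c₂ ^ 2 * CΔ) * K ^ 2 * (1 + C) / B ^ 2 +
        4 * (p + 1) ^ 2 * (c₂ + c₂ ^ 2 * CΔ) * K ^ 4 * C / ρ ^ 2 / P.N := by
  have hN' : (0 : ℝ) < P.N := by exact_mod_cast hN
  have hsN : 0 < √(P.N : ℝ) := Real.sqrt_pos.2 hN'
  have hK0 : 0 < K := one_pos.trans_le hK
  let E₁ : Fin (p + 1) → Set (Finset (Fin P.N)) := fun k =>
    {A | B * √P.N < |∑ i ∈ A, P.d i * P.z G i k - ∑ i, P.z G i k|}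
  let E₂ : Fin (p + 1) × Fin (p + 1) → Set (Finset (Fin P.N)) := fun kl =>
    {A | ρ / 2 * P.N < |∑ i ∈ A, P.d i * (P.z G i kl.1 * P.z G i kl.2) -
      ∑ i, P.z G i kl.1 * P.z G i kl.2|}
  -- Off these deviations the matrix `T` below is within `ρ` of `S`: half from sampling, half from
  -- `hS`. Dropping the weights `d_i < c₂` costs the factor `1 / c₂` in `κ`.
  have hsub : (P.goodSamples G (q / c₂) B)ᶜ ⊆ (⋃ k, E₁ k) ∪ ⋃ kl, E₂ kl := by
    refine Set.compl_subset_comm.1 fun A hA => ?_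
    rw [Set.mem_compl_iff, Set.mem_union, not_or, Set.mem_iUnion, Set.mem_iUnion, not_exists,
      not_exists] at hA
    refine ⟨fun k => not_lt.1 (hA.1 k), fun v => ?_⟩
    obtain ⟨T, hTdef⟩ : ∃ T : Matrix (Fin (p + 1)) (Fin (p + 1)) ℝ,
        T = (P.N : ℝ)⁻¹ • ∑ i ∈ A, P.d i • vecMulVec (P.z G i) (P.z G i) := ⟨_, rfl⟩
    have hT : ∀ k l, |T k l - S k l| ≤ ρ := fun k l => by
      have h1 : |∑ i ∈ A, P.d i * (P.z G i k * P.z G i l) - ∑ i, P.z G i k * P.z G i l| ≤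
          ρ / 2 * P.N := not_lt.1 (hA.2 (k, l))
      have h2 := hS k l
      rw [hTdef]
      simp only [Matrix.smul_apply, Matrix.sum_apply, vecMulVec_apply, smul_eq_mul]
      have h3 : (P.N : ℝ)⁻¹ * ∑ i ∈ A, P.d i * (P.z G i k * P.z G i l) - S k l =
          (P.N : ℝ)⁻¹ * (∑ i ∈ A, P.d i * (P.z G i k * P.z G i l) - ∑ i, P.z G i k * P.z G i l) +
          ((P.N : ℝ)⁻¹ * ∑ i, P.z G i k * P.z G i l - S k l) := by ring
      rw [h3]
      refine (abs_add_le _ _).trans ?_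
      have h4 : |(P.N : ℝ)⁻¹ * (∑ i ∈ A, P.d i * (P.z G i k * P.z G i l) -
          ∑ i, P.z G i k * P.z G i l)| ≤ ρ / 2 := by
        rw [abs_mul, abs_of_pos (inv_pos.2 hN'), inv_mul_le_iff₀ hN', mul_comm]
        exact h1
      linarith
    have h1 := hq _ hT v
    have h2 : v ⬝ᵥ T *ᵥ v = (P.N : ℝ)⁻¹ * ∑ i ∈ A, P.d i * (P.z G i ⬝ᵥ v) ^ 2 := by
      rw [hTdef, smul_mulVec, dotProduct_smul, sum_mulVec, dotProduct_sum, smul_eq_mul]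
      congr 1
      refine Finset.sum_congr rfl fun i _ => ?_
      rw [smul_mulVec, dotProduct_smul, vecMulVec_mulVec, dotProduct_smul]
      simp only [smul_eq_mul, MulOpposite.smul_eq_mul_unop, MulOpposite.unop_op]
      rw [dotProduct_comm v]
      ring
    have h3 : ∑ i ∈ A, P.d i * (P.z G i ⬝ᵥ v) ^ 2 ≤ c₂ * ∑ i ∈ A, (P.z G i ⬝ᵥ v) ^ 2 := by
      rw [Finset.mul_sum]
      exact Finset.sum_le_sum fun i _ => mul_le_mul_of_nonneg_right (hd i).2.le (sq_nonneg _)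
    rw [h2, le_inv_mul_iff₀ hN'] at h1
    have h4 := h1.trans h3
    rw [div_mul_eq_mul_div, div_mul_eq_mul_div, div_le_iff₀ hc₂]
    linarith
  have hK' : 0 ≤ c₂ + c₂ ^ 2 * CΔ := by positivity
  -- Deviations of order `√N` match the standard deviation: the bound is free of `N` and small only
  -- for large `B`. For `E₂` the deviations are of order `N`, which leaves a factor `1 / N`.
  have h1 : ∀ k, P.prob (E₁ k) ≤ (c₂ + c₂ ^ 2 * CΔ) * K ^ 2 * (1 + C) / B ^ 2 := fun k => by
    refine (P.prob_lt_abs_horvitzThompson_sub_le hc₁ hCΔ hd hΔ (fun i => P.z G i k)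
      (mul_pos hB hsN)).trans ?_
    have h2 : ∑ i, P.z G i k ^ 2 ≤ K ^ 2 * ((1 + C) * P.N) := by
      refine le_trans ?_ (mul_le_mul_of_nonneg_left (sum_normSq_le hC) (sq_nonneg K))
      rw [Finset.mul_sum]
      refine Finset.sum_le_sum fun i _ => ?_
      rw [← sq_abs]
      refine (pow_le_pow_left₀ (abs_nonneg _) (abs_z_le hK (hg i) k) 2).trans_eq ?_
      rw [mul_pow, Real.sq_sqrt (P.normSq_nonneg i)]
    rw [mul_pow, Real.sq_sqrt hN'.le]
    calc _ ≤ (c₂ + c₂ ^ 2 * CΔ) * (K ^ 2 * ((1 + C) * P.N)) / (B ^ 2 * P.N) := by gcongr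
      _ = _ := by field_simp
  have h2 : ∀ kl, P.prob (E₂ kl) ≤
      4 * (c₂ + c₂ ^ 2 * CΔ) * K ^ 4 * C / ρ ^ 2 / P.N := fun kl => by
    refine (P.prob_lt_abs_horvitzThompson_sub_le hc₁ hCΔ hd hΔ
      (fun i => P.z G i kl.1 * P.z G i kl.2) (mul_pos (half_pos hρ) hN')).trans ?_
    have h2 : ∑ i, (P.z G i kl.1 * P.z G i kl.2) ^ 2 ≤ K ^ 4 * (C * P.N) := by
      refine le_trans ?_ (mul_le_mul_of_nonneg_left hC (by positivity))
      rw [Finset.mul_sum]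
      refine Finset.sum_le_sum fun i _ => ?_
      rw [← sq_abs, abs_mul]
      refine (pow_le_pow_left₀ (by positivity) (mul_le_mul (abs_z_le hK (hg i) kl.1)
        (abs_z_le hK (hg i) kl.2) (abs_nonneg _) (by positivity)) 2).trans_eq ?_
      rw [mul_mul_mul_comm, Real.mul_self_sqrt (P.normSq_nonneg i)]
      ring
    calc _ ≤ (c₂ + c₂ ^ 2 * CΔ) * (K ^ 4 * (C * P.N)) / (ρ / 2 * P.N) ^ 2 := by gcongr
      _ = _ := by field_simp; ring
  refine (P.prob_mono hsub).trans ((P.prob_union_le _ _).trans (add_le_add ?_ ?_))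
  · refine (P.prob_iUnion_le E₁).trans ((Finset.sum_le_sum fun k _ => h1 k).trans_eq ?_)
    rw [Finset.sum_const, Finset.card_univ, Fintype.card_fin, nsmul_eq_mul]
    push_cast; ring
  · refine (P.prob_iUnion_le E₂).trans ((Finset.sum_le_sum fun k _ => h2 k).trans_eq ?_)
    rw [Finset.sum_const, Finset.card_univ, Fintype.card_prod, Fintype.card_fin, nsmul_eq_mul]
    push_cast; ring

/-! ### Uniform existence and expansion on good samples. -/

/-- On good samples of large populations, the calibration weights exist and are unique, and the
calibration estimator is within `ε √N` of the regression estimator with coefficient `γ` as soon as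
`γ̂` is close to `γ`. -/
theorem exists_calibration_expansion {V : Set ℝ} (hGconv : StrictConvexOn ℝ V G)
    (hGdiff : ContDiffOn ℝ 2 G V) (hg' : ∀ w ∈ interior V, 0 < deriv (deriv G) w) {c₁ c₂ : ℝ}
    (hc₁V : c₁ ∈ interior V) (hc₂V : c₂ ∈ interior V) (h12 : c₁ ≤ c₂) {c₀ κ B C ε : ℝ}
    (hc₀ : 0 < c₀) (hκ : 0 < κ) (hB : 0 < B) (hC0 : 0 ≤ C) (hε : 0 < ε)
    (γ : Fin (p + 1) → ℝ) :
    ∃ ε' : ℝ, 0 < ε' ∧ ∃ N₀ : ℝ, ∀ P : SurveyPopulation p, N₀ ≤ P.N → 0 < P.N →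
      (∀ i, c₁ < P.d i ∧ P.d i < c₂) → (∀ i, c₀ ≤ P.c i) → ∑ i, P.normSq i ^ 2 ≤ C * P.N →
      ∀ A ∈ P.goodSamples G κ B, (∃! ω, P.IsCalibrationWeight G V A ω) ∧
        ∀ ω, P.IsCalibrationWeight G V A ω → ‖P.gammaHat G A - γ‖ ≤ ε' →
          |P.linearEstimator A ω - P.greg G γ A| ≤ ε * √P.N := by
  obtain ⟨a, b, m, M, K, ha, hb, hab, hm, hM, hK, hdG, hdg, hlo, hhi, hgK, hcont'⟩ :=
    exists_Icc_deriv_bounds hGconv.1 hGdiff hg' hc₁V hc₂V h12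
  obtain ⟨h, μ, L, hμ, hL, hcont, hmono, hlip, hhg, hgh⟩ :=
    exists_biLipschitz_inverse (by linarith) hm hdg hlo hhi
  have hK0 : 0 < K := one_pos.trans_le hK
  obtain ⟨D, hD⟩ : ∃ D, D = ((p : ℝ) + 1) * K := ⟨_, rfl⟩
  have hD0 : 0 < D := by rw [hD]; positivity
  obtain ⟨κ₁, hκ₁⟩ : ∃ κ₁, κ₁ = κ ^ 2 / (((p + 1) * K) ^ 2 * (1 + 2 * C)) := ⟨_, rfl⟩
  have hκ₁0 : 0 < κ₁ := by rw [hκ₁]; positivity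
  obtain ⟨R, hR⟩ : ∃ R, R = (2 * ((p + 1) * B) + 1) / (μ * κ₁) := ⟨_, rfl⟩
  have hR0 : 0 < R := by rw [hR]; positivity
  have hRB : 2 * ((p + 1) * B) < μ * κ₁ * R := by
    rw [hR, mul_div_cancel₀ _ (by positivity)]
    exact lt_add_one _
  obtain ⟨F, hF⟩ : ∃ F, F = D * (1 + D * ‖γ‖) := ⟨_, rfl⟩
  have hF0 : 0 < F := by rw [hF]; positivity
  -- `η`, the allowed oscillation of `g'`, spends half of `ε` on the remainder; `ε'` below spends
  -- the other half on `γ̂ - γ`.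
  obtain ⟨η, hη⟩ : ∃ η, η = ε / (2 * ((1 + C) * R * (L / (m * c₀)) * F)) := ⟨_, rfl⟩
  have hη0 : 0 < η := by rw [hη]; positivity
  obtain ⟨ρ, hρ, huc⟩ := Metric.uniformContinuousOn_iff_le.1
    (isCompact_Icc.uniformContinuousOn_of_continuous hcont') η hη0
  -- Weights within `δ` of the `d_i` stay in `[a, b]` and change `g'` by at most `η`. The choice of
  -- `s` makes the displacement bound `L D s R / c₀` equal to `δ`.
  obtain ⟨δ, hδ⟩ : ∃ δ, δ = min ρ (min (c₁ - a) (b - c₂)) := ⟨_, rfl⟩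
  have hδ0 : 0 < δ := by
    rw [hδ]
    exact lt_min hρ (lt_min (by linarith) (by linarith))
  obtain ⟨s, hs⟩ : ∃ s, s = δ * c₀ / (L * D * R) := ⟨_, rfl⟩
  have hs0 : 0 < s := by rw [hs]; positivity
  refine ⟨ε * (m * c₀) / (2 * ((1 + C) * R * D ^ 2)), by positivity, C / s ^ 4,
    fun P hN₀ hN hd hc hCP A hA => ?_⟩
  have hN' : (0 : ℝ) < P.N := by exact_mod_cast hN
  have hsN : 0 < √(P.N : ℝ) := Real.sqrt_pos.2 hN'
  have hcp : ∀ i, 0 < P.c i := fun i => hc₀.trans_le (hc i)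
  have hdI : ∀ i, P.d i ∈ Set.Icc a b := fun i => ⟨by linarith [(hd i).1], by linarith [(hd i).2]⟩
  have hg : ∀ i, |deriv G (P.d i)| ≤ K := fun i => hgK _ (hdI i)
  obtain ⟨v, hv, hsol, hvδ, hvL⟩ := exists_solution_of_mem_goodSamples hκ hN hC0 hCP hK hg hc₀ hc
    hcont hμ hL.le hmono hlip (fun i => hhg _ (hdI i)) hR0 (hκ₁ ▸ hRB)
    (sqrt_normSq_le_mul_sqrt hCP hs0 hN₀)
    (δ := δ) (by rw [← hD, hs]; refine le_of_eq ?_; field_simp) hA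
  set w : Fin P.N → ℝ := fun i => h (deriv G (P.d i) + P.z G i ⬝ᵥ v / P.c i) with hw
  have hwI : ∀ i ∈ A, w i ∈ Set.Icc a b := fun i hi => by
    have h1 := abs_le.1 (hvδ i hi)
    have h2 : δ ≤ c₁ - a := hδ ▸ (min_le_right _ _).trans (min_le_left _ _)
    have h3 : δ ≤ b - c₂ := hδ ▸ (min_le_right _ _).trans (min_le_right _ _)
    have h4 := hd i
    constructor <;> simp only [hw] <;> linarith
  have hcal : P.IsCalibrationWeight G V A fun i => w i :=
    isCalibrationWeight_of_inverse hGconv.convexOn hcp hab hdG hgh hsol hwI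
  have huniq : ∀ ω, P.IsCalibrationWeight G V A ω → ω = fun i : A => w i :=
    fun ω hω => hω.eq hGconv hcp hcal
  refine ⟨⟨_, hcal, huniq⟩, fun ω hω hγ => ?_⟩
  rw [huniq ω hω]
  have hlin : P.linearEstimator A (fun i => w i) = ∑ i ∈ A, w i * P.y i :=
    Finset.sum_coe_sort A fun i => w i * P.y i
  rw [hlin]
  -- Since `g'(d_i) ≤ M`, the extra factor in the denominator costs at most `1 / M`.
  have hpos : ∀ v : Fin (p + 1) → ℝ, κ₁ * P.N / M * ‖v‖ ^ 2 ≤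
      ∑ i ∈ A, (P.z G i ⬝ᵥ v) ^ 2 / (deriv (deriv G) (P.d i) * P.c i) := fun v => by
    have h1 := le_sum_sq_div_of_mem_goodSamples hκ hN hC0 hCP hK hg hcp hA v
    rw [← hκ₁] at h1
    rw [div_mul_eq_mul_div, div_le_iff₀ hM, Finset.sum_mul]
    refine h1.trans (Finset.sum_le_sum fun i _ => ?_)
    have h2 := hm.trans_le (hlo _ (hdI i))
    have h3 := hhi _ (hdI i)
    have h4 := hcp i
    rw [← div_div, div_right_comm, div_mul_eq_mul_div, le_div_iff₀ h2]
    exact mul_le_mul_of_nonneg_left h3 (by positivity)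
  have hrem : ∀ i ∈ A, |w i - P.d i - P.z G i ⬝ᵥ v / (deriv (deriv G) (P.d i) * P.c i)| ≤
      η * (L / (m * c₀)) * |P.z G i ⬝ᵥ v| := fun i hi => by
    have h1 := abs_sub_sub_div_deriv_le hm hdg (hdI i) (hwI i hi) (hlo _ (hdI i)) (η := η)
      fun x hx hxd => by
        have := huc x hx _ (hdI i) (by
          rw [Real.dist_eq]
          exact hxd.trans ((hvδ i hi).trans (hδ ▸ min_le_left _ _)))
        rwa [Real.dist_eq] at this
    have h2 : deriv G (w i) - deriv G (P.d i) = P.z G i ⬝ᵥ v / P.c i := by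
      rw [hgh _ (hwI i hi), add_sub_cancel_left]
    rw [h2, div_div, mul_comm (P.c i)] at h1
    refine h1.trans ?_
    calc _ ≤ η / m * (L / c₀ * |P.z G i ⬝ᵥ v|) :=
          mul_le_mul_of_nonneg_left (hvL i hi) (by positivity)
      _ = _ := by field_simp
  have hmain := abs_sum_mul_y_sub_greg_le hsol γ v hK hg hm (fun i => hlo _ (hdI i)) hc₀ hc
    (by positivity) hpos (by positivity) hrem (sum_normSq_le hCP)
  rw [← hD, ← hF] at hmain
  refine hmain.trans ?_
  calc _ ≤ (1 + C) * P.N * (R / √P.N) *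
        (D ^ 2 / (m * c₀) * (ε * (m * c₀) / (2 * ((1 + C) * R * D ^ 2))) +
          η * (L / (m * c₀)) * F) := by gcongr
    _ = ε * (P.N / √P.N) := by
        rw [hη]
        field_simp
        ring
    _ = _ := by rw [Real.div_sqrt]

/-! ### Rates and limits in design probability. -/

/-- Because `n ≤ N`, an error `ε √N` is within the stated rate, whatever the random sample size. -/
theorem sqrt_le_card_rpow_mul {A : Finset (Fin P.N)} (hA : A.Nonempty) :
    √(P.N : ℝ) ≤ (A.card : ℝ) ^ (-(1 / 2) : ℝ) * P.N := by
  have h0 : (0 : ℝ) < A.card := by exact_mod_cast hA.card_pos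
  have h1 : (A.card : ℝ) ≤ P.N := by
    have := A.card_le_univ
    rw [Fintype.card_fin] at this
    exact_mod_cast this
  rw [Real.rpow_neg h0.le, ← Real.sqrt_eq_rpow, ← div_eq_inv_mul,
    le_div_iff₀ (Real.sqrt_pos.2 h0)]
  calc √(P.N : ℝ) * √A.card ≤ √P.N * √P.N := by gcongr
    _ = _ := Real.mul_self_sqrt (Nat.cast_nonneg _)

theorem tendsto_prob_zero {P : ℕ → SurveyPopulation p} {E : ∀ ν, Set (Finset (Fin (P ν).N))}
    (h : ∀ τ : ℝ, 0 < τ → ∀ᶠ ν in atTop, (P ν).prob (E ν) ≤ τ) :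
    Tendsto (fun ν => (P ν).prob (E ν)) atTop (𝓝 0) := by
  refine tendsto_order.2 ⟨fun τ hτ => Eventually.of_forall fun ν =>
    hτ.trans_le ((P ν).prob_nonneg _), fun τ hτ => ?_⟩
  filter_upwards [h (τ / 2) (half_pos hτ)] with ν hν
  linarith

theorem tendsto_prob_one {P : ℕ → SurveyPopulation p} {E : ∀ ν, Set (Finset (Fin (P ν).N))}
    (h : ∀ τ : ℝ, 0 < τ → ∀ᶠ ν in atTop, (P ν).prob (E ν)ᶜ ≤ τ) :
    Tendsto (fun ν => (P ν).prob (E ν)) atTop (𝓝 1) := by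
  have h1 := (tendsto_prob_zero h).const_sub 1
  rw [sub_zero] at h1
  refine h1.congr fun ν => ?_
  linarith [(P ν).prob_add_prob_compl (E ν)]

end SurveyPopulation

theorem theorem3 {p : ℕ} (P : ℕ → SurveyPopulation p)
    -- the population sizes tend to infinity
    (hN : Tendsto (fun ν => (P ν).N) atTop atTop)
    -- `G` is strictly convex and `C²` on the interval `V`, with `g' = G'' > 0` inside `V`
    (G : ℝ → ℝ) (V : Set ℝ) (hGconv : StrictConvexOn ℝ V G) (hGdiff : ContDiffOn ℝ 2 G V)
    (hg' : ∀ w ∈ interior V, 0 < deriv (deriv G) w)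
    -- the design weights are bounded by positive constants inside `V`
    (c₁ c₂ : ℝ) (hc₁ : 0 < c₁) (hc₁V : c₁ ∈ interior V) (hc₂V : c₂ ∈ interior V)
    (hd : ∀ ν i, c₁ < (P ν).d i ∧ (P ν).d i < c₂)
    -- `limsup N * max_{i ≠ j} |π_ij - π_i π_j| < ∞`
    (hΔ : ∃ C : ℝ, ∀ᶠ ν in atTop, ∀ i j, i ≠ j →
      ((P ν).N : ℝ) * |(P ν).incl₂ i j - (P ν).incl i * (P ν).incl j| ≤ C)
    -- the variance factors are bounded away from zero
    (c₀ : ℝ) (hc₀ : 0 < c₀) (hc : ∀ ν i, c₀ ≤ (P ν).c i)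
    -- `lim N⁻¹ ∑_U z_i z_iᵀ` exists and is positive definite
    (S : Matrix (Fin (p + 1)) (Fin (p + 1)) ℝ) (hSpos : S.PosDef)
    (hS : Tendsto (fun ν => ((P ν).N : ℝ)⁻¹ • ∑ i, vecMulVec ((P ν).z G i) ((P ν).z G i))
      atTop (𝓝 S))
    -- `limsup N⁻¹ ∑_U ‖(y_i, x_i, c_i)‖⁴ < ∞`
    (hmom : ∃ C : ℝ, ∀ᶠ ν in atTop,
      ((P ν).N : ℝ)⁻¹ *
        ∑ i, ((P ν).y i ^ 2 + (∑ k, (P ν).x i k ^ 2) + (P ν).c i ^ 2) ^ 2 ≤ C) :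
    -- with probability tending to one the calibration weights exist and are unique
    Tendsto (fun ν => (P ν).prob {A | ∃! ω, (P ν).IsCalibrationWeight G V A ω}) atTop (𝓝 1) ∧
    -- `θ̂_cal = θ̂_greg(γ*) + o_p(n^{-1/2} N)`, where `γ*` is the probability limit of `γ̂` and
    -- the weights `ω̂` are minimizers for every sample for which minimizers exist
    ∀ γstar : Fin (p + 1) → ℝ,
      TendstoInDesignProb P (fun ν A => (P ν).gammaHat G A) γstar →
      ∀ ωhat : ∀ ν, ∀ A : Finset (Fin (P ν).N), A → ℝ,
        (∀ ν A, (∃ ω, (P ν).IsCalibrationWeight G V A ω) →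
          (P ν).IsCalibrationWeight G V A (ωhat ν A)) →
        IsLittleODesignProb P
          (fun ν A => (P ν).linearEstimator A (ωhat ν A) - (P ν).greg G γstar A)
          (fun ν A => (A.card : ℝ) ^ (-(1 / 2) : ℝ) * ((P ν).N : ℝ)) := by
  -- A nonempty population is needed to infer `c₁ ≤ c₂` from `c₁ < d_i < c₂`.
  obtain ⟨ν₀, hν₀⟩ := (hN.eventually_ge_atTop 1).exists
  have h12 : c₁ ≤ c₂ := ((hd ν₀ ⟨0, hν₀⟩).1.trans (hd ν₀ ⟨0, hν₀⟩).2).le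
  have hc₂ : 0 < c₂ := hc₁.trans_le h12
  obtain ⟨a, b, m, M, K, ha, hb, -, -, -, hK, -, -, -, -, hgK, -⟩ :=
    exists_Icc_deriv_bounds hGconv.1 hGdiff hg' hc₁V hc₂V h12
  have hg : ∀ ν i, |deriv G ((P ν).d i)| ≤ K := fun ν i =>
    hgK _ ⟨(ha.trans (hd ν i).1).le, ((hd ν i).2.trans hb).le⟩
  obtain ⟨CΔ, hCΔ⟩ := hΔ
  obtain ⟨C, hC⟩ := hmom
  obtain ⟨q, ρ, hq, hρ, hqT⟩ := hSpos.exists_forall_le_dotProduct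
  have hNpos : ∀ᶠ ν in atTop, 0 < (P ν).N := hN.eventually_gt_atTop 0
  have hNge : ∀ r : ℝ, ∀ᶠ ν in atTop, r ≤ (P ν).N := fun r =>
    (tendsto_natCast_atTop_atTop.comp hN).eventually_ge_atTop r
  have hmom : ∀ᶠ ν in atTop, ∑ i, (P ν).normSq i ^ 2 ≤ |C| * (P ν).N := by
    filter_upwards [hC, hNpos] with ν hν hν'
    have h1 : (0 : ℝ) < (P ν).N := by exact_mod_cast hν'
    have h2 := hν.trans (le_abs_self C)
    rw [inv_mul_le_iff₀ h1, mul_comm] at h2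
    exact h2
  have hSkl : ∀ᶠ ν in atTop, ∀ k l,
      |((P ν).N : ℝ)⁻¹ * ∑ i, (P ν).z G i k * (P ν).z G i l - S k l| ≤ ρ / 2 := by
    refine eventually_all.2 fun k => eventually_all.2 fun l => ?_
    have h1 := tendsto_pi_nhds.1 (tendsto_pi_nhds.1 hS k) l
    filter_upwards [Metric.tendsto_nhds.1 h1 (ρ / 2) (half_pos hρ)] with ν hν
    rw [Real.dist_eq] at hν
    simpa [Matrix.sum_apply, vecMulVec_apply] using hν.le
  have hgood : ∀ τ : ℝ, 0 < τ → ∃ B : ℝ, 0 < B ∧ ∀ᶠ ν in atTop,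
      (P ν).prob ((P ν).goodSamples G (q / c₂) B)ᶜ ≤ τ := by
    intro τ hτ
    obtain ⟨k₁, hk₁⟩ : ∃ k, k = ((p : ℝ) + 1) * (c₂ + c₂ ^ 2 * |CΔ|) * K ^ 2 * (1 + |C|) :=
      ⟨_, rfl⟩
    obtain ⟨k₂, hk₂⟩ : ∃ k, k = 4 * ((p : ℝ) + 1) ^ 2 * (c₂ + c₂ ^ 2 * |CΔ|) * K ^ 4 * |C| / ρ ^ 2 :=
      ⟨_, rfl⟩
    have hk₁0 : 0 ≤ k₁ := by rw [hk₁]; positivity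
    -- This gives `B² ≥ 2 k₁ / τ`, so the term constant in `N` is at most `τ / 2`; large `N` handles
    -- the other.
    refine ⟨√(2 * k₁ / τ) + 1, by positivity, ?_⟩
    filter_upwards [hCΔ, hmom, hNpos, hSkl, hNge (2 * k₂ / τ)] with ν h1 h2 h3 h4 h5
    refine (SurveyPopulation.prob_compl_goodSamples_le hc₁ (abs_nonneg CΔ) (hd ν)
      (fun i j hij => (h1 i j hij).trans (le_abs_self _)) h2 hK (hg ν) h3 hc₂ hρ hqT h4
      (B := √(2 * k₁ / τ) + 1) (by positivity)).trans ?_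
    rw [← hk₁, ← hk₂]
    have h6 : k₁ / (√(2 * k₁ / τ) + 1) ^ 2 ≤ τ / 2 := by
      rw [div_le_iff₀ (by positivity)]
      have e1 : 2 * k₁ / τ ≤ (√(2 * k₁ / τ) + 1) ^ 2 := by
        have := Real.sq_sqrt (show 0 ≤ 2 * k₁ / τ by positivity)
        nlinarith [Real.sqrt_nonneg (2 * k₁ / τ)]
      rw [div_le_iff₀ hτ] at e1
      linarith
    have h7 : k₂ / (P ν).N ≤ τ / 2 := by
      have e1 : (0 : ℝ) < (P ν).N := by exact_mod_cast h3
      rw [div_le_iff₀ hτ] at h5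
      rw [div_le_iff₀ e1]
      linarith
    linarith
  refine ⟨SurveyPopulation.tendsto_prob_one fun τ hτ => ?_, fun γstar hγ ωhat hω ε hε =>
    SurveyPopulation.tendsto_prob_zero fun τ hτ => ?_⟩
  · obtain ⟨B, hB, hprob⟩ := hgood τ hτ
    -- Only existence and uniqueness are used here, so `ε = 1` and `γ = 0` are arbitrary.
    obtain ⟨_, -, N₀, hexp⟩ := SurveyPopulation.exists_calibration_expansion hGconv hGdiff hg'
      hc₁V hc₂V h12 hc₀ (div_pos hq hc₂) hB (abs_nonneg C) one_pos (0 : Fin (p + 1) → ℝ)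
    filter_upwards [hprob, hmom, hNpos, hNge N₀] with ν h1 h2 h3 h4
    refine ((P ν).prob_mono (Set.compl_subset_compl.2 fun A hA => ?_)).trans h1
    exact (hexp (P ν) h4 h3 (hd ν) (hc ν) h2 A hA).1
  · obtain ⟨B, hB, hprob⟩ := hgood (τ / 2) (half_pos hτ)
    obtain ⟨ε', hε', N₀, hexp⟩ := SurveyPopulation.exists_calibration_expansion hGconv hGdiff hg'
      hc₁V hc₂V h12 hc₀ (div_pos hq hc₂) hB (abs_nonneg C) hε γstar
    have hγ' := (hγ ε' hε').eventually_le_const (half_pos hτ)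
    filter_upwards [hprob, hmom, hNpos, hNge N₀, hγ'] with ν h1 h2 h3 h4 h5
    -- A large error requires a bad sample or `γ̂` far from `γ*`; each has probability at most `τ /
    -- 2`.
    have hsub : {A | ε * ((A.card : ℝ) ^ (-(1 / 2) : ℝ) * ((P ν).N : ℝ)) <
        |(P ν).linearEstimator A (ωhat ν A) - (P ν).greg G γstar A|} ⊆
        ((P ν).goodSamples G (q / c₂) B)ᶜ ∪ {A | ε' < dist ((P ν).gammaHat G A) γstar} := by
      intro A hA
      by_contra hnot
      rw [Set.mem_union, not_or, Set.mem_compl_iff, not_not] at hnot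
      obtain ⟨hexist, hbound⟩ := hexp (P ν) h4 h3 (hd ν) (hc ν) h2 A hnot.1
      have h6 := hbound _ (hω ν A hexist.exists)
        ((dist_eq_norm _ _).symm.le.trans (not_lt.1 hnot.2))
      have h7 := SurveyPopulation.sqrt_le_card_rpow_mul
        (SurveyPopulation.nonempty_of_mem_goodSamples (div_pos hq hc₂) h3 hnot.1)
      exact absurd hA (not_lt.2 (h6.trans (mul_le_mul_of_nonneg_left h7 hε.le)))
    refine ((P ν).prob_mono hsub).trans (((P ν).prob_union_le _ _).trans ?_)
    linarith
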